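/- Fix an integer $m\ge 2$. For $n\ge 1$ define the random mapping with anti-preferential attachment $T_n^m:[n]\to[n]$, where $[n]=\{1,\dots,n\}$, as follows. There are $n$ urns, each containing $m$ balls initially. In round $k=1,\dots,n$, given the choices made in all earlier rounds, urn $j$ is chosen with probability $b_j/\sum_{i=1}^n b_i$, where $b_i$ is the number of balls in urn $i$ at the start of round $k$; if urn $j$ is chosen, put $T_n^m(k)=j$ and remove one ball from urn $j$. Let $G_n^m$ be the directed graph on $[n]$ with an edge from $i$ to $T_n^m(i)$ for each $i$, and let $L_1^{(n)}\ge L_2^{(n)}\ge\cdots$ be the sizes (numbers of vertices) of the connected components of $G_n^m$ (of the underlying undirected graph) in decreasing order, with $L_i^{(n)}=0$ if $i$ exceeds the number of components. Let $$\nabla=\Big\{(x_i)_{i\ge 1}:\ \sum_{i} x_i\le 1,\ x_i\ge x_{i+1}\ge 0\text{ for every } i\ge 1\Big\}$$ with the topology of coordinatewise convergence. Then, as $n\to\infty$, the sequence $\big(L_1^{(n)}/n,\,L_2^{(n)}/n,\,\dots\big)$ converges in distribution on $\nabla$ to the Poisson–Dirichlet$(1/2)$ distribution, that is, to the law of the decreasing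 rearrangement of the sequence $B_1,\ B_2(1-B_1),\ B_3(1-B_1)(1-B_2),\dots$, where $B_1,B_2,\dots$ are independent with common density $\tfrac12(1-u)^{-1/2}$ on $(0,1)$. -/

import Mathlib

open MeasureTheory ProbabilityTheory Filter Topology
open scoped ENNReal

noncomputable section

namespace AntiPref

/-! ### The urn scheme and the random mapping -/

/-- The contents of the `n` urns after the `k` draws recorded in `h`: initially every urn holds `m`
balls, and each draw removes one ball from the urn that was drawn. -/
def urnContents (m n : ℕ) : (k : ℕ) → (Fin k → Fin n) → Fin n → ℕ
  | 0, _ => fun _ => m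
  | k + 1, h =>
    Function.update (urnContents m n k (Fin.init h)) (h (Fin.last k))
      (urnContents m n k (Fin.init h) (h (Fin.last k)) - 1)

theorem urnContents_total (m n : ℕ) :
    ∀ (k : ℕ) (h : Fin k → Fin n), n * m ≤ (∑ j, urnContents m n k h j) + k
  | 0, _ => by simp [urnContents]
  | k + 1, h => by
    have ih := urnContents_total m n k (Fin.init h)
    simp only [urnContents]
    rw [Finset.sum_update_of_mem (Finset.mem_univ _)]
    have hs := Finset.add_sum_erase Finset.univ (urnContents m n k (Fin.init h))
      (Finset.mem_univ (h (Fin.last k)))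
    rw [← Finset.sdiff_singleton_eq_erase] at hs
    omega

theorem urnContents_total_ne_zero {m n k : ℕ} (hm : 0 < m) (hk : k < n) (h : Fin k → Fin n) :
    ∑ j, urnContents m n k h j ≠ 0 := by
  have h1 := urnContents_total m n k h
  have h2 : n ≤ n * m := Nat.le_mul_of_pos_right n hm
  omega

/-- The choice of an urn when the contents are `b`: urn `j` is chosen with probability
`b j / ∑ i, b i`. -/
def draw {n : ℕ} (b : Fin n → ℕ) (hb : ∑ j, b j ≠ 0) : PMF (Fin n) :=
  PMF.ofFintype (fun j => (b j : ℝ≥0∞) / ((∑ i, b i : ℕ) : ℝ≥0∞)) (by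
    simp only [div_eq_mul_inv]
    rw [← Finset.sum_mul, ← Nat.cast_sum]
    exact ENNReal.mul_inv_cancel (by exact_mod_cast hb) (ENNReal.natCast_ne_top _))

/-- The joint law of the first `k` choices in the urn scheme: given all earlier choices, the next
urn is drawn with probability proportional to its current number of balls. -/
def urnLaw (m n : ℕ) (hm : 0 < m) : (k : ℕ) → k ≤ n → PMF (Fin k → Fin n)
  | 0, _ => PMF.pure Fin.elim0
  | k + 1, hk =>
    (urnLaw m n hm k (Nat.le_of_succ_le hk)).bind fun h =>
      (draw (urnContents m n k h) (urnContents_total_ne_zero hm hk h)).map fun j =>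
        Fin.snoc (α := fun _ => Fin n) h j

/-- The law of the random mapping with anti-preferential attachment on `n` vertices with parameter
`m`: vertex `k` is mapped to the urn chosen in round `k`. -/
def mappingLaw (m n : ℕ) (hm : 0 < m) : PMF (Fin n → Fin n) := urnLaw m n hm n le_rfl

/-! ### The functional digraph and its components -/

/-- The directed graph of a mapping, with an edge from `i` to `j` iff `f i = j`. -/
def mapDigraph {n : ℕ} (f : Fin n → Fin n) : Digraph (Fin n) where
  Adj i j := f i = j

/-- The (weakly connected) components of the directed graph of a mapping. -/
abbrev Component {n : ℕ} (f : Fin n → Fin n) : Type :=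
  (mapDigraph f).toSimpleGraphInclusive.ConnectedComponent

/-- The number of vertices of a component. -/
def Component.size {n : ℕ} {f : Fin n → Fin n} (c : Component f) : ℕ := c.supp.ncard

theorem Component.sum_size_le {n : ℕ} {f : Fin n → Fin n} (s : Finset (Component f)) :
    ∑ c ∈ s, c.size ≤ n := by
  classical
  let g : Fin n → Component f :=
    fun i => (mapDigraph f).toSimpleGraphInclusive.connectedComponentMk i
  have h1 : ∀ c : Component f, c.size = (Finset.univ.filter fun i => g i = c).card := by
    intro c
    rw [Component.size, ← Set.ncard_coe_finset]
    congr 1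
    ext i
    simp [g, SimpleGraph.ConnectedComponent.mem_supp_iff]
  have h2 : ∑ c ∈ s, c.size = (Finset.univ.filter fun i => g i ∈ s).card := by
    rw [Finset.card_eq_sum_card_fiberwise (f := g) (t := s) (by intro i; simp)]
    refine Finset.sum_congr rfl fun c hc => ?_
    rw [h1 c]
    congr 1
    ext i
    simp only [Finset.mem_filter, Finset.mem_univ, true_and]
    constructor
    · rintro rfl; exact ⟨hc, rfl⟩
    · exact fun h => h.2
  rw [h2]
  exact (Finset.card_le_univ _).trans (by simp)

/-! ### Ranked sequences and the simplex -/

/-- The simplex of nonincreasing nonnegative sequences with sum at most one, with the topology of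
coordinatewise convergence. -/
def rankedSimplex : Set (ℕ → ℝ) :=
  {x | (∀ i, x (i + 1) ≤ x i) ∧ (∀ i, 0 ≤ x i) ∧ Summable x ∧ ∑' i, x i ≤ 1}

/-- The numbers `t` which are `0`, or are at most `x i` for at least `k + 1` indices `i`. -/
def rankedSet {ι : Type*} (x : ι → ℝ) (k : ℕ) : Set ℝ :=
  {t | t = 0 ∨ ∃ s : Finset ι, s.card = k + 1 ∧ ∀ i ∈ s, t ≤ x i}

/-- The `(k + 1)`-st largest term, counted with multiplicity, of a family of nonnegative numbers
(`0` if the family has fewer than `k + 1` terms). -/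
def ranked {ι : Type*} (x : ι → ℝ) (k : ℕ) : ℝ := sSup (rankedSet x k)

section Ranked

variable {ι : Type*} {x : ι → ℝ}

theorem zero_mem_rankedSet (x : ι → ℝ) (k : ℕ) : (0 : ℝ) ∈ rankedSet x k := Or.inl rfl

theorem bddAbove_rankedSet (h1 : ∀ i, x i ≤ 1) (k : ℕ) : BddAbove (rankedSet x k) := by
  refine ⟨1, ?_⟩
  rintro t (rfl | ⟨s, hs, h⟩)
  · exact zero_le_one
  · obtain ⟨i, hi⟩ : s.Nonempty := Finset.card_pos.1 (by omega)
    exact (h i hi).trans (h1 i)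

theorem le_one_of_sum_le (h1 : ∀ s : Finset ι, ∑ i ∈ s, x i ≤ 1) (i : ι) : x i ≤ 1 := by
  simpa using h1 {i}

theorem exists_sum_le (h0 : ∀ i, 0 ≤ x i) (t : ℕ → ℝ) (ht : ∀ k, t k ∈ rankedSet x k) :
    ∀ n : ℕ, ∃ s : Finset ι, s.card ≤ n ∧ ∑ k ∈ Finset.range n, t k ≤ ∑ i ∈ s, x i
  | 0 => ⟨∅, by simp⟩
  | n + 1 => by
    classical
    obtain ⟨s, hs, hsum⟩ := exists_sum_le h0 t ht n
    rw [Finset.sum_range_succ]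
    rcases ht n with h | ⟨u, hu, h⟩
    · exact ⟨s, by omega, by rw [h]; simpa using hsum⟩
    · obtain ⟨i, hi, his⟩ : ∃ i ∈ u, i ∉ s := Finset.exists_mem_notMem_of_card_lt_card (by omega)
      refine ⟨insert i s, ?_, ?_⟩
      · rw [Finset.card_insert_of_notMem his]; omega
      · rw [Finset.sum_insert his]
        linarith [h i hi]

theorem ranked_nonneg (h1 : ∀ i, x i ≤ 1) (k : ℕ) : 0 ≤ ranked x k :=
  le_csSup (bddAbove_rankedSet h1 k) (zero_mem_rankedSet x k)

theorem ranked_succ_le (h1 : ∀ i, x i ≤ 1) (k : ℕ) : ranked x (k + 1) ≤ ranked x k := by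
  refine csSup_le_csSup (bddAbove_rankedSet h1 k) ⟨0, zero_mem_rankedSet x _⟩ ?_
  rintro t (rfl | ⟨s, hs, h⟩)
  · exact Or.inl rfl
  · obtain ⟨u, hus, hu⟩ := Finset.exists_subset_card_eq (s := s) (n := k + 1) (by omega)
    exact Or.inr ⟨u, hu, fun i hi => h i (hus hi)⟩

theorem sum_ranked_le (h0 : ∀ i, 0 ≤ x i) (h1 : ∀ s : Finset ι, ∑ i ∈ s, x i ≤ 1) (n : ℕ) :
    ∑ k ∈ Finset.range n, ranked x k ≤ 1 := by
  refine le_of_forall_pos_le_add fun ε hε => ?_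
  have hδ : 0 < ε / (n + 1) := by positivity
  have hex : ∀ k, ∃ t ∈ rankedSet x k, ranked x k - ε / (n + 1) < t := fun k =>
    exists_lt_of_lt_csSup ⟨0, zero_mem_rankedSet x k⟩ (by rw [← ranked]; linarith)
  choose t ht hlt using hex
  obtain ⟨s, -, hs⟩ := exists_sum_le h0 t ht n
  have h2 : ∑ k ∈ Finset.range n, (ranked x k - ε / (n + 1)) ≤ ∑ k ∈ Finset.range n, t k :=
    Finset.sum_le_sum fun k _ => (hlt k).le
  rw [Finset.sum_sub_distrib, Finset.sum_const, Finset.card_range, nsmul_eq_mul] at h2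
  have h3 : (n : ℝ) * (ε / (n + 1)) ≤ ε := by
    rw [← mul_div_assoc, div_le_iff₀ (by positivity)]
    nlinarith
  linarith [h1 s]

theorem ranked_mem (h0 : ∀ i, 0 ≤ x i) (h1 : ∀ s : Finset ι, ∑ i ∈ s, x i ≤ 1) :
    ranked x ∈ rankedSimplex := by
  have h2 := le_one_of_sum_le h1
  exact ⟨ranked_succ_le h2, ranked_nonneg h2,
    summable_of_sum_range_le (ranked_nonneg h2) (sum_ranked_le h0 h1),
    Real.tsum_le_of_sum_range_le (ranked_nonneg h2) (sum_ranked_le h0 h1)⟩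

theorem lt_ranked_iff (h1 : ∀ i, x i ≤ 1) (k : ℕ) (a : ℝ) :
    a < ranked x k ↔ a < 0 ∨ ∃ s : Finset ι, s.card = k + 1 ∧ ∀ i ∈ s, a < x i := by
  rw [ranked, lt_csSup_iff (bddAbove_rankedSet h1 k) ⟨0, zero_mem_rankedSet x k⟩]
  constructor
  · rintro ⟨t, rfl | ⟨s, hs, h⟩, hat⟩
    · exact Or.inl hat
    · exact Or.inr ⟨s, hs, fun i hi => hat.trans_le (h i hi)⟩
  · rintro (h | ⟨s, hs, h⟩)
    · exact ⟨0, zero_mem_rankedSet x k, h⟩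
    · have hne : s.Nonempty := Finset.card_pos.1 (by omega)
      exact ⟨s.inf' hne x, Or.inr ⟨s, hs, fun i hi => Finset.inf'_le x hi⟩,
        (Finset.lt_inf'_iff hne).2 h⟩

end Ranked

/-- The normalized order statistics of the component sizes of a mapping: the component sizes divided
by `n`, in decreasing order, followed by zeros. -/
def componentOrderStatistics {n : ℕ} (f : Fin n → Fin n) : rankedSimplex :=
  ⟨ranked fun c : Component f => (c.size : ℝ) / n, ranked_mem (fun _ => by positivity) fun s => by
    rw [← Finset.sum_div, ← Nat.cast_sum]
    exact div_le_one_of_le₀ (by exact_mod_cast Component.sum_size_le s) (Nat.cast_nonneg n)⟩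

/-- The joint law of the normalized order statistics of the component sizes of the random mapping
with anti-preferential attachment. -/
def componentLaw (m n : ℕ) (hm : 0 < m) : ProbabilityMeasure rankedSimplex :=
  ⟨((mappingLaw m n hm).map componentOrderStatistics).toMeasure, inferInstance⟩

/-! ### The Poisson–Dirichlet distribution -/

/-- The `Beta(1, θ)` law, with density `θ (1 - u) ^ (θ - 1)`, on the unit interval. -/
def betaUnit (θ : ℝ) : Measure unitInterval := (betaMeasure 1 θ).comap Subtype.val

theorem isProbabilityMeasure_betaUnit {θ : ℝ} (hθ : 0 < θ) :
    IsProbabilityMeasure (betaUnit θ) := by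
  have := isProbabilityMeasureBeta one_pos hθ
  constructor
  rw [betaUnit, comap_subtype_coe_apply measurableSet_Icc, Set.image_univ, Subtype.range_coe]
  rw [prob_compl_eq_zero_iff measurableSet_Icc |>.symm, betaMeasure,
    withDensity_apply _ measurableSet_Icc.compl]
  refine setLIntegral_eq_zero measurableSet_Icc.compl fun u hu => ?_
  rcases lt_or_ge u 0 with h | h
  · exact betaPDF_eq_zero_of_nonpos h.le
  · refine betaPDF_eq_zero_of_one_le (le_of_not_ge fun h' => hu ⟨h, h'⟩)

/-- The stick-breaking sequence `b 0, b 1 (1 - b 0), b 2 (1 - b 0) (1 - b 1), …`. -/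
def stick (b : ℕ → unitInterval) (k : ℕ) : ℝ :=
  b k * ∏ i ∈ Finset.range k, (1 - (b i : ℝ))

theorem stick_nonneg (b : ℕ → unitInterval) (k : ℕ) : 0 ≤ stick b k :=
  mul_nonneg (b k).2.1 (Finset.prod_nonneg fun i _ => sub_nonneg.2 (b i).2.2)

theorem sum_stick_le (b : ℕ → unitInterval) (s : Finset ℕ) : ∑ k ∈ s, stick b k ≤ 1 := by
  have h : ∀ n, ∑ k ∈ Finset.range n, stick b k = 1 - ∏ i ∈ Finset.range n, (1 - (b i : ℝ)) := by
    intro n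
    induction n with
    | zero => simp
    | succ n ih => rw [Finset.sum_range_succ, ih, Finset.prod_range_succ, stick]; ring
  obtain ⟨n, hn⟩ := s.exists_nat_subset_range
  refine (Finset.sum_le_sum_of_subset_of_nonneg hn fun k _ _ => stick_nonneg b k).trans ?_
  rw [h n]
  have : 0 ≤ ∏ i ∈ Finset.range n, (1 - (b i : ℝ)) :=
    Finset.prod_nonneg fun i _ => sub_nonneg.2 (b i).2.2
  linarith

/-- The stick-breaking sequence rearranged in decreasing order. -/
def rankedStick (b : ℕ → unitInterval) : rankedSimplex :=
  ⟨ranked (stick b), ranked_mem (stick_nonneg b) (sum_stick_le b)⟩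

theorem measurable_rankedStick : Measurable rankedStick := by
  refine Measurable.subtype_mk (measurable_pi_lambda _ fun k => measurable_of_Ioi fun a => ?_)
  have h : (fun b : ℕ → unitInterval => ranked (stick b) k) ⁻¹' Set.Ioi a =
      {_b | a < 0} ∪ ⋃ s : Finset ℕ, ⋃ _ : s.card = k + 1, ⋂ i ∈ s, {b | a < stick b i} := by
    ext b
    simp [lt_ranked_iff (le_one_of_sum_le (sum_stick_le b))]
  rw [h]
  refine MeasurableSet.union (MeasurableSet.const _) (MeasurableSet.iUnion fun s =>
    MeasurableSet.iUnion fun _ => Finset.measurableSet_biInter s fun i _ => ?_)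
  refine measurableSet_lt measurable_const ?_
  unfold stick
  fun_prop

/-- The Poisson–Dirichlet distribution with parameter `θ > 0`: the law of the decreasing
rearrangement of the stick-breaking sequence of independent `Beta(1, θ)` variables. -/
def poissonDirichlet (θ : ℝ) (hθ : 0 < θ) : ProbabilityMeasure rankedSimplex :=
  ⟨(Measure.infinitePi fun _ : ℕ => betaUnit θ).map rankedStick,
    haveI := isProbabilityMeasure_betaUnit hθ
    Measure.isProbabilityMeasure_map measurable_rankedStick.aemeasurable⟩

end AntiPref

end

/-! The proof is by the method of moments on the simplex. On `rankedSimplex`, which is compact, the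
power sums `∑ x i ^ j` with `j ≥ 2` are continuous and separate points, so by the Stone–Weierstrass
theorem it is enough that the expectations of products of such power sums converge
(`tendsto_of_powerSum_moments`).

A mapping `f` has probability `∏ v, (m)_{d v} / (n m)_n`, where `d v` is the indegree of `v` and
`(·)_k` the falling factorial (`urnLaw_apply`). This weight is multiplicative over the components.
Hence, given that the component of a vertex is a set `S` of `k` vertices, `f` restricted to the
complement is again a mapping of the same type on `n - k` vertices (`card_mul_momentSum`), and the
mixed moments of the power sums of the component sizes satisfy the recursion
`componentMoment_recursion`. The stick-breaking sequence satisfies the same recursion with the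
normalized size `k / n` replaced by a `Beta(1, 1/2)` variable `B`
(`poissonDirichlet_moment_recursion`). The term in which no power sum receives a contribution from
the first component carries a factor `((n - k) / n) ^ b` with `b ≥ 1`, so it is asymptotically a
contraction, and the convergence of the mixed moments follows by induction on the number of factors
(`tendsto_of_block_recursion`) once the moments of `(n - k) / n` converge to those of `1 - B`, namely
`1 / (2 b + 1)`.

With `z n = (m n).choose n`, the total weight divided by `n!`, the size `k` has probability
`c k * z (n - k) / (n * z n)` for some `c ≥ 0`, where `n * z n = ∑ k, c k * z (n - k)`. By Stirling's
formula `z n` is, up to a geometric factor, asymptotically proportional to the coefficients of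
`(1 - x) ^ (-1/2)`. Since the square of this series is `(1 - x)⁻¹`, convolving the identity with its
coefficients shows that the partial sums of the normalized `c` grow like `n / 2` without any formula
for `c` (`tendsto_conv_one`), and comparison with the coefficients of `(1 - x) ^ (-(b + 1/2))` gives
the moments (`tendsto_renewal_moment`). -/

noncomputable section

namespace AntiPref

/-! ### Components of a mapping and their weights -/

/-- Two points lie in the same component of the functional digraph of `f` iff their forward orbits
meet. -/
def Conn {V : Type*} (f : V → V) (u v : V) : Prop := ∃ i j : ℕ, f^[i] u = f^[j] v

theorem Conn.refl {V : Type*} (f : V → V) (u : V) : Conn f u u := ⟨0, 0, rfl⟩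

theorem Conn.symm {V : Type*} {f : V → V} {u v : V} : Conn f u v → Conn f v u :=
  fun ⟨i, j, h⟩ => ⟨j, i, h.symm⟩

theorem Conn.trans {V : Type*} {f : V → V} {u v w : V} : Conn f u v → Conn f v w → Conn f u w := by
  rintro ⟨i, j, h⟩ ⟨k, l, h'⟩
  refine ⟨k + i, j + l, ?_⟩
  rw [Function.iterate_add_apply, h, ← Function.iterate_add_apply, add_comm k j,
    Function.iterate_add_apply, h', ← Function.iterate_add_apply]

theorem Conn.apply {V : Type*} (f : V → V) (u : V) : Conn f u (f u) := ⟨1, 0, rfl⟩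

section Defs

variable {V : Type*} [Fintype V] [DecidableEq V]

/-- The number of preimages of `v`. -/
def indegree {U : Type*} [Fintype U] (f : U → V) (v : V) : ℕ := ∑ u, if f u = v then 1 else 0

/-- The number of ways of drawing balls, in order and without replacement, from urns with `m`
distinguishable balls each, so that the successive urns are the values of `f`. -/
def weight (m : ℕ) {U : Type*} [Fintype U] (f : U → V) : ℕ :=
  ∏ v, m.descFactorial (indegree f v)

open Classical in
/-- The number of vertices in the component of `u`. -/
def blockSize (f : V → V) (u : V) : ℕ := ∑ v, if Conn f u v then 1 else 0

/-- The sum of the `j`-th powers of the component sizes, for `j ≥ 1`: each component is counted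
once for each of its vertices. -/
def sizePowerSum (f : V → V) (j : ℕ) : ℕ := ∑ v, blockSize f v ^ (j - 1)

variable {ι : Type*}

/-- The unnormalized mixed moments of the power sums of the component sizes. -/
def momentSum (m : ℕ) (V : Type*) [Fintype V] [DecidableEq V] (J : ι → ℕ) (s : Finset ι) : ℕ :=
  ∑ f : V → V, weight m f * ∏ i ∈ s, sizePowerSum f (J i)

open Classical in
/-- The total weight of the mappings with a single component. -/
def connWeight (m : ℕ) (V : Type*) [Fintype V] [DecidableEq V] : ℕ :=
  ∑ f : V → V, if ∀ u v, Conn f u v then weight m f else 0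

end Defs

section Transport

variable {V W : Type*}

theorem conj_iterate (e : V ≃ W) (f : V → V) (i : ℕ) (v : V) :
    (e.conj f)^[i] (e v) = e (f^[i] v) := by
  induction i generalizing v with
  | zero => rfl
  | succ i ih => rw [Function.iterate_succ_apply, Function.iterate_succ_apply, ← ih]; simp

theorem conn_conj (e : V ≃ W) (f : V → V) (u v : V) : Conn (e.conj f) (e u) (e v) ↔ Conn f u v := by
  simp only [Conn, conj_iterate, e.apply_eq_iff_eq]

variable [Fintype V] [Fintype W]

theorem indegree_conj [DecidableEq V] [DecidableEq W] (e : V ≃ W) (f : V → V) (v : V) :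
    indegree (e.conj f) (e v) = indegree f v := by
  unfold indegree
  rw [← e.sum_comp]
  simp

theorem weight_conj [DecidableEq V] [DecidableEq W] (e : V ≃ W) (m : ℕ) (f : V → V) :
    weight m (e.conj f) = weight m f := by
  unfold weight
  rw [← e.prod_comp]
  simp only [indegree_conj]

theorem blockSize_conj (e : V ≃ W) (f : V → V) (v : V) :
    blockSize (e.conj f) (e v) = blockSize f v := by
  classical
  unfold blockSize
  rw [← e.sum_comp]
  exact Finset.sum_congr rfl fun w _ => if_congr (conn_conj e f v w) rfl rfl

theorem sizePowerSum_conj (e : V ≃ W) (f : V → V) (j : ℕ) :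
    sizePowerSum (e.conj f) j = sizePowerSum f j := by
  unfold sizePowerSum
  rw [← e.sum_comp]
  simp only [blockSize_conj]

theorem momentSum_congr [DecidableEq V] [DecidableEq W] (e : V ≃ W) (m : ℕ) {ι : Type*}
    (J : ι → ℕ) (s : Finset ι) :
    momentSum m V J s = momentSum m W J s := by
  unfold momentSum
  rw [← e.conj.sum_comp]
  simp only [weight_conj, sizePowerSum_conj]

theorem connWeight_congr [DecidableEq V] [DecidableEq W] (e : V ≃ W) (m : ℕ) :
    connWeight m V = connWeight m W := by
  unfold connWeight
  rw [← e.conj.sum_comp]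
  refine Finset.sum_congr rfl fun f _ => ?_
  rw [weight_conj]
  congr 1
  rw [eq_iff_iff, ← e.forall_congr_right]
  refine forall_congr' fun u => ?_
  rw [← e.forall_congr_right]
  simp only [conn_conj]

end Transport

section SumMap

variable {α β : Type*} (g : α → α) (h : β → β)

theorem sumMap_iterate_inl (i : ℕ) (a : α) :
    (Sum.map g h)^[i] (Sum.inl a) = Sum.inl (g^[i] a) := by
  induction i generalizing a with
  | zero => rfl
  | succ i ih => exact ih (g a)

theorem sumMap_iterate_inr (i : ℕ) (b : β) :
    (Sum.map g h)^[i] (Sum.inr b) = Sum.inr (h^[i] b) := by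
  induction i generalizing b with
  | zero => rfl
  | succ i ih => exact ih (h b)

@[simp] theorem conn_inl_inl (a a' : α) :
    Conn (Sum.map g h) (Sum.inl a) (Sum.inl a') ↔ Conn g a a' := by
  simp [Conn, sumMap_iterate_inl]

@[simp] theorem conn_inr_inr (b b' : β) :
    Conn (Sum.map g h) (Sum.inr b) (Sum.inr b') ↔ Conn h b b' := by
  simp [Conn, sumMap_iterate_inr]

@[simp] theorem conn_inl_inr (a : α) (b : β) :
    ¬ Conn (Sum.map g h) (Sum.inl a) (Sum.inr b) := by
  simp [Conn, sumMap_iterate_inl, sumMap_iterate_inr]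

@[simp] theorem conn_inr_inl (a : α) (b : β) :
    ¬ Conn (Sum.map g h) (Sum.inr b) (Sum.inl a) := by
  simp [Conn, sumMap_iterate_inl, sumMap_iterate_inr]

variable [Fintype α] [Fintype β]

theorem weight_sumMap [DecidableEq α] [DecidableEq β] (m : ℕ) :
    weight m (Sum.map g h) = weight m g * weight m h := by
  simp only [weight, indegree, Fintype.prod_sum_type, Fintype.sum_sum_type, Sum.map_inl,
    Sum.map_inr, Sum.inl.injEq, Sum.inr.injEq, reduceCtorEq, if_false, Finset.sum_const_zero,
    add_zero, zero_add]

theorem sizePowerSum_sumMap (j : ℕ) :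
    sizePowerSum (Sum.map g h) j = sizePowerSum g j + sizePowerSum h j := by
  classical
  simp only [sizePowerSum, blockSize, Fintype.sum_sum_type, conn_inl_inr, conn_inr_inl, if_false,
    Finset.sum_const_zero, add_zero, zero_add]
  congr 1
  · exact Finset.sum_congr rfl fun a _ => congrArg (· ^ (j - 1))
      (Finset.sum_congr rfl fun b _ => if_congr (conn_inl_inl g h a b) rfl rfl)
  · exact Finset.sum_congr rfl fun a _ => congrArg (· ^ (j - 1))
      (Finset.sum_congr rfl fun b _ => if_congr (conn_inr_inr g h a b) rfl rfl)

theorem sizePowerSum_of_conn (hg : ∀ u v, Conn g u v) {j : ℕ} (hj : j ≠ 0) :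
    sizePowerSum g j = Fintype.card α ^ j := by
  simp [sizePowerSum, blockSize, hg, mul_pow_sub_one hj]

variable {ι : Type*} [DecidableEq ι] [DecidableEq α] [DecidableEq β]

open Classical in
/-- The contribution of the mappings of `α ⊕ β` for which `α` is a component. -/
theorem sum_component_inl (m : ℕ) {J : ι → ℕ} (hJ : ∀ i, J i ≠ 0) (s : Finset ι) :
    (∑ f : α ⊕ β → α ⊕ β, if ∀ a v, Conn f (Sum.inl a) v ↔ v.isLeft then
      weight m f * ∏ i ∈ s, sizePowerSum f (J i) else 0) =
    connWeight m α * ∑ t ∈ s.powerset,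
      Fintype.card α ^ (∑ i ∈ t, J i) * momentSum m β J (s \ t) := by
  have key := Fintype.sum_of_injective
    (fun p : (α → α) × (β → β) => (Sum.map p.1 p.2 : α ⊕ β → α ⊕ β))
    (fun p p' hp => by
      refine Prod.ext (funext fun a => ?_) (funext fun b => ?_)
      · simpa using congrFun hp (Sum.inl a)
      · simpa using congrFun hp (Sum.inr b))
    (fun p => if ∀ u v, Conn p.1 u v then
      weight m p.1 * (weight m p.2 * ∏ i ∈ s, (Fintype.card α ^ J i + sizePowerSum p.2 (J i)))
      else 0)
    (fun f => if ∀ a v, Conn f (Sum.inl a) v ↔ v.isLeft then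
      weight m f * ∏ i ∈ s, sizePowerSum f (J i) else 0) ?_ ?_
  · rw [← key, Fintype.sum_prod_type, connWeight, Finset.sum_mul]
    refine Finset.sum_congr rfl fun g _ => ?_
    split_ifs with hg
    · dsimp only
      rw [← Finset.mul_sum]
      congr 1
      simp only [momentSum, Finset.mul_sum]
      rw [Finset.sum_comm]
      refine Finset.sum_congr rfl fun h _ => ?_
      rw [Finset.prod_add, Finset.mul_sum]
      refine Finset.sum_congr rfl fun t _ => ?_
      rw [Finset.prod_pow_eq_pow_sum]
      ring
    · simp
  · intro f hf
    rw [if_neg]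
    intro hcl
    apply hf
    have hl : ∀ a, ∃ a', f (Sum.inl a) = Sum.inl a' := fun a =>
      Sum.isLeft_iff.1 ((hcl a _).1 (Conn.apply f _))
    have hr : ∀ b, ∃ b', f (Sum.inr b) = Sum.inr b' := by
      intro b
      rcases hb : f (Sum.inr b) with a | b'
      · have h1 := (Conn.apply f (Sum.inr b)).symm
        rw [hb, hcl] at h1
        simp at h1
      · exact ⟨b', rfl⟩
    choose g hg using hl
    choose h hh using hr
    refine ⟨(g, h), funext fun v => ?_⟩
    rcases v with a | b
    · simp [hg]
    · simp [hh]
  · rintro ⟨g, h⟩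
    have : (∀ a v, Conn (Sum.map g h) (Sum.inl a) v ↔ v.isLeft) ↔ ∀ u v, Conn g u v := by
      simp [Sum.forall]
    simp only [this]
    split_ifs with hg
    · rw [weight_sumMap, mul_assoc]
      congr 2
      refine Finset.prod_congr rfl fun i _ => ?_
      rw [sizePowerSum_sumMap, sizePowerSum_of_conn g hg (hJ i)]
    · rfl

end SumMap

section Decomposition

variable {V : Type*} [Fintype V] [DecidableEq V] {ι : Type*} [DecidableEq ι]

open Classical in
/-- The contribution of the mappings for which `S`, if nonempty, is a component. -/
theorem sum_component_eq (m : ℕ) {J : ι → ℕ} (hJ : ∀ i, J i ≠ 0) (s : Finset ι) (S : Finset V) :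
    (∑ f : V → V, if ∀ u ∈ S, ∀ v, Conn f u v ↔ v ∈ S then
      weight m f * ∏ i ∈ s, sizePowerSum f (J i) else 0) =
    connWeight m (Fin S.card) * ∑ t ∈ s.powerset,
      S.card ^ (∑ i ∈ t, J i) * momentSum m (Fin (Fintype.card V - S.card)) J (s \ t) := by
  let e : V ≃ {x // x ∈ S} ⊕ {x // x ∉ S} := (Equiv.sumCompl (· ∈ S)).symm
  have hα : Fintype.card {x // x ∈ S} = S.card := Fintype.card_coe S
  have hβ : Fintype.card {x // x ∉ S} = Fintype.card V - S.card := by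
    rw [Fintype.card_subtype_compl, hα]
  rw [← connWeight_congr (Fintype.equivFinOfCardEq hα)]
  simp only [← momentSum_congr (Fintype.equivFinOfCardEq hβ)]
  have := sum_component_inl (α := {x // x ∈ S}) (β := {x // x ∉ S}) m hJ s
  rw [hα] at this
  rw [← this, ← e.conj.sum_comp]
  refine Finset.sum_congr rfl fun f _ => ?_
  simp only [weight_conj, sizePowerSum_conj]
  congr 1
  rw [eq_iff_iff, Subtype.forall]
  refine forall_congr' fun u => forall_congr' fun hu => ?_
  rw [← e.forall_congr_right]
  refine forall_congr' fun v => ?_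
  have h1 : (Sum.inl ⟨u, hu⟩ : {x // x ∈ S} ⊕ {x // x ∉ S}) = e u := by
    simp [e, Equiv.eq_symm_apply]
  rw [h1, conn_conj]
  have h2 : (e v).isLeft = true ↔ v ∈ S := by
    by_cases hv : v ∈ S
    · simp [e, hv]
    · simp [e, hv]
  rw [h2]

/-- The first-component decomposition of the mixed moments, averaged over the starting vertex. -/
theorem card_mul_momentSum (m : ℕ) {J : ι → ℕ} (hJ : ∀ i, J i ≠ 0) (s : Finset ι) :
    Fintype.card V * momentSum m V J s = ∑ k ∈ Finset.range (Fintype.card V + 1),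
      (Fintype.card V).choose k * (k * (connWeight m (Fin k) * ∑ t ∈ s.powerset,
        k ^ (∑ i ∈ t, J i) * momentSum m (Fin (Fintype.card V - k)) J (s \ t))) := by
  classical
  have h1 : Fintype.card V * momentSum m V J s = ∑ S : Finset V, S.card *
      ∑ f : V → V, if ∀ u ∈ S, ∀ v, Conn f u v ↔ v ∈ S then
        weight m f * ∏ i ∈ s, sizePowerSum f (J i) else 0 := by
    simp only [Finset.mul_sum, momentSum]
    rw [Finset.sum_comm]
    refine Finset.sum_congr rfl fun f _ => ?_
    have h2 : ∀ S : Finset V, (S.card * if ∀ u ∈ S, ∀ v, Conn f u v ↔ v ∈ S then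
        weight m f * ∏ i ∈ s, sizePowerSum f (J i) else 0) =
        ∑ u : V, if S = Finset.univ.filter (Conn f u) then
          weight m f * ∏ i ∈ s, sizePowerSum f (J i) else 0 := by
      intro S
      rw [← smul_eq_mul, ← Finset.sum_const, ← Finset.sum_filter_add_sum_filter_not Finset.univ
        (· ∈ S) (fun u => if S = Finset.univ.filter (Conn f u) then
          weight m f * ∏ i ∈ s, sizePowerSum f (J i) else 0)]
      rw [Finset.sum_eq_zero (s := Finset.univ.filter (· ∉ S)), add_zero, Finset.filter_univ_mem]
      · refine Finset.sum_congr rfl fun u hu => ?_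
        congr 1
        rw [eq_iff_iff]
        constructor
        · intro h
          ext v
          simp [h u hu v]
        · intro h u' hu' v
          have h3 : ∀ w, w ∈ S ↔ Conn f u w := fun w => by
            conv_lhs => rw [h]
            simp
          rw [h3 v]
          exact ⟨((h3 u').1 hu').trans, ((h3 u').1 hu').symm.trans⟩
      · intro u hu
        rw [if_neg]
        rintro rfl
        simp [Conn.refl] at hu
    simp only [h2]
    rw [Finset.sum_comm]
    simp
  rw [h1]
  simp only [sum_component_eq m hJ s]
  rw [← Finset.powerset_univ, Finset.sum_powerset_apply_card (fun k => k * (connWeight m (Fin k) *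
    ∑ t ∈ s.powerset, k ^ (∑ i ∈ t, J i) * momentSum m (Fin (Fintype.card V - k)) J (s \ t)))]
  simp

end Decomposition

/-! ### The law of the urn scheme -/

theorem indegree_succ {n k : ℕ} (h : Fin (k + 1) → Fin n) (j : Fin n) :
    indegree h j = indegree (Fin.init h) j + if h (Fin.last k) = j then 1 else 0 := by
  unfold indegree
  rw [Fin.sum_univ_castSucc]
  rfl

theorem sum_indegree {n k : ℕ} (h : Fin k → Fin n) : ∑ j, indegree h j = k := by
  unfold indegree
  rw [Finset.sum_comm]
  simp

theorem urnContents_eq (m n : ℕ) : ∀ (k : ℕ) (h : Fin k → Fin n) (j : Fin n),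
    urnContents m n k h j = m - indegree h j
  | 0, h, j => by simp [urnContents, indegree]
  | k + 1, h, j => by
    rw [urnContents, indegree_succ, Function.update_apply]
    split_ifs with h1 h2 h2
    · rw [h1, urnContents_eq]; omega
    · exact absurd h1.symm h2
    · exact absurd h2.symm h1
    · rw [urnContents_eq]; omega

/-- No draw has been made from an empty urn if the weight does not vanish, so that the truncated
subtraction in the contents of the urns is exact. -/
theorem sum_urnContents {m n k : ℕ} (h : Fin k → Fin n) (hw : weight m h ≠ 0) :
    ∑ j, urnContents m n k h j = n * m - k := by
  have hle : ∀ j, indegree h j ≤ m := by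
    intro j
    by_contra hj
    exact hw (Finset.prod_eq_zero (Finset.mem_univ j)
      (Nat.descFactorial_eq_zero_iff_lt.2 (not_le.1 hj)))
  have h1 : ∑ j, (urnContents m n k h j + indegree h j) = n * m := by
    rw [Finset.sum_congr rfl fun j _ => show _ = m by rw [urnContents_eq]; have := hle j; omega]
    simp
  rw [Finset.sum_add_distrib, sum_indegree] at h1
  omega

theorem weight_succ {m n k : ℕ} (h : Fin (k + 1) → Fin n) :
    weight m h = weight m (Fin.init h) * urnContents m n k (Fin.init h) (h (Fin.last k)) := by
  unfold weight
  rw [← Finset.mul_prod_erase _ _ (Finset.mem_univ (h (Fin.last k))),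
    ← Finset.mul_prod_erase _ _ (Finset.mem_univ (h (Fin.last k))), urnContents_eq,
    indegree_succ, if_pos rfl, Nat.descFactorial_succ]
  rw [Finset.prod_congr rfl fun j hj => by
    rw [indegree_succ, if_neg (Finset.ne_of_mem_erase hj).symm, add_zero]]
  ring

/-- The first `k` choices have given values with probability proportional to the number of ways of
drawing corresponding balls. -/
theorem urnLaw_apply (m n : ℕ) (hm : 0 < m) : ∀ (k : ℕ) (hk : k ≤ n) (h : Fin k → Fin n),
    urnLaw m n hm k hk h = (weight m h : ℝ≥0∞) / ((n * m).descFactorial k : ℕ)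
  | 0, _, h => by
    rw [urnLaw, PMF.pure_apply, if_pos (Subsingleton.elim _ _)]
    simp [weight, indegree]
  | k + 1, hk, h => by
    rw [urnLaw, PMF.bind_apply, tsum_eq_single (Fin.init h)]
    · rw [PMF.map_apply, tsum_eq_single (h (Fin.last k)), if_pos (Fin.snoc_init_self h).symm,
        urnLaw_apply]
      · have hd : draw (urnContents m n k (Fin.init h))
            (urnContents_total_ne_zero hm hk (Fin.init h)) (h (Fin.last k)) =
            (urnContents m n k (Fin.init h) (h (Fin.last k)) : ℝ≥0∞) /
            ((∑ i, urnContents m n k (Fin.init h) i : ℕ) : ℝ≥0∞) := PMF.ofFintype_apply _ _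
        rw [hd, weight_succ, Nat.cast_mul]
        rcases eq_or_ne (weight m (Fin.init h)) 0 with h0 | h0
        · simp [h0]
        · rw [sum_urnContents _ h0, Nat.descFactorial_succ, Nat.cast_mul, mul_comm ((n * m - k : ℕ) : ℝ≥0∞),
            ENNReal.mul_div_mul_comm]
          · right; exact ENNReal.natCast_ne_top _
          · left; exact ENNReal.natCast_ne_top _
      · intro j hj
        rw [if_neg]
        intro he
        apply hj
        rw [he, Fin.snoc_last]
    · intro h' hh'
      rw [PMF.map_apply]
      simp only [mul_eq_zero]
      right
      refine ENNReal.tsum_eq_zero.2 fun j => if_neg fun he => hh' ?_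
      rw [he, Fin.init_snoc]

theorem sum_weight {m : ℕ} (hm : 0 < m) (n : ℕ) :
    ∑ f : Fin n → Fin n, weight m f = (n * m).descFactorial n := by
  have h := (mappingLaw m n hm).tsum_coe
  rw [tsum_fintype] at h
  simp only [mappingLaw, urnLaw_apply] at h
  have h0 : (((n * m).descFactorial n : ℕ) : ℝ≥0∞) ≠ 0 := by
    have : n ≤ n * m := Nat.le_mul_of_pos_right n hm
    rw [Nat.cast_ne_zero, ne_eq, Nat.descFactorial_eq_zero_iff_lt]
    omega
  simp only [div_eq_mul_inv] at h
  rw [← Finset.sum_mul, ← div_eq_mul_inv, ENNReal.div_eq_one_iff h0 (ENNReal.natCast_ne_top _)] at h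
  exact_mod_cast h

theorem integral_componentLaw {m n : ℕ} (hm : 0 < m) (F : rankedSimplex → ℝ)
    (hF : Continuous F) :
    ∫ x, F x ∂(componentLaw m n hm : Measure rankedSimplex) =
      (∑ f : Fin n → Fin n, weight m f * F (componentOrderStatistics f)) /
        ((n * m).descFactorial n : ℕ) := by
  have hmeas : Measurable (componentOrderStatistics (n := n)) := measurable_of_countable _
  change ∫ x, F x ∂((mappingLaw m n hm).map componentOrderStatistics).toMeasure = _
  rw [← PMF.toMeasure_map _ _ hmeas, integral_map hmeas.aemeasurable
    hF.measurable.aestronglyMeasurable, PMF.integral_eq_sum, Finset.sum_div]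
  refine Finset.sum_congr rfl fun f _ => ?_
  rw [mappingLaw, urnLaw_apply, ENNReal.toReal_div, smul_eq_mul]
  simp only [ENNReal.toReal_natCast]
  ring

/-! ### Convolutions of sequences -/

open Finset.HasAntidiagonal in
/-- The convolution of two sequences. -/
def conv (a b : ℕ → ℝ) (n : ℕ) : ℝ := ∑ p ∈ antidiagonal n, a p.1 * b p.2

theorem conv_eq_coeff (a b : ℕ → ℝ) (n : ℕ) :
    conv a b n = PowerSeries.coeff n (PowerSeries.mk a * PowerSeries.mk b) := by
  simp [conv, PowerSeries.coeff_mul]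

theorem mk_conv (a b : ℕ → ℝ) :
    PowerSeries.mk (conv a b) = PowerSeries.mk a * PowerSeries.mk b := by
  ext n
  rw [PowerSeries.coeff_mk, conv_eq_coeff]

theorem conv_comm (a b : ℕ → ℝ) : conv a b = conv b a := by
  funext n
  rw [conv_eq_coeff, mul_comm, ← conv_eq_coeff]

theorem conv_assoc (a b c : ℕ → ℝ) : conv (conv a b) c = conv a (conv b c) := by
  funext n
  rw [conv_eq_coeff, conv_eq_coeff, mk_conv, mk_conv, mul_assoc]

theorem tendsto_shift_div {a r : ℕ → ℝ} (ha : ∀ n, 0 ≤ a n) (hr0 : ∀ n, 0 < r n)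
    (hr : Monotone r) (har : Tendsto (fun n => a n / r n) atTop (𝓝 0)) (i : ℕ) :
    Tendsto (fun n => a (n - i) / r n) atTop (𝓝 0) := by
  refine squeeze_zero (fun n => div_nonneg (ha _) (hr0 _).le) (fun n => ?_)
    (har.comp (tendsto_sub_atTop_nat i))
  exact div_le_div_of_nonneg_left (ha _) (hr0 _) (hr (Nat.sub_le n i))

/-- The values of `φ` at finitely many indices do not affect the growth of `conv a φ`, because `a` is
of smaller order than `r`. -/
theorem tendsto_conv_zero {a φ h r : ℕ → ℝ} {ℓ : ℝ} (ha : ∀ n, 0 ≤ a n) (hr0 : ∀ n, 0 < r n)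
    (hr : Monotone r) (har : Tendsto (fun n => a n / r n) atTop (𝓝 0)) (hh : ∀ n, 0 < h n)
    (hφ : Tendsto (fun n => φ n / h n) atTop (𝓝 0))
    (hl : Tendsto (fun n => conv a h n / r n) atTop (𝓝 ℓ)) :
    Tendsto (fun n => conv a φ n / r n) atTop (𝓝 0) := by
  rw [Metric.tendsto_atTop]
  intro δ hδ
  have hε : 0 < δ / (2 * (|ℓ| + 1)) := by positivity
  set ε := δ / (2 * (|ℓ| + 1)) with hεdef
  obtain ⟨N, hN⟩ := (Metric.tendsto_atTop.1 hφ) ε hε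
  have hN' : ∀ n, N ≤ n → |φ n| ≤ ε * h n := by
    intro n hn
    have := hN n hn
    rw [Real.dist_eq, sub_zero, abs_div, abs_of_pos (hh n), div_lt_iff₀ (hh n)] at this
    exact this.le
  have h1 : Tendsto (fun n => ∑ i ∈ Finset.range N, a (n - i) / r n * |φ i|) atTop (𝓝 0) := by
    have := tendsto_finsetSum (Finset.range N) fun i _ =>
      (tendsto_shift_div ha hr0 hr har i).mul_const (|φ i|)
    simpa using this
  have h2 := ((hl.const_mul ε).add h1)
  have h3 : ε * ℓ + 0 < δ := by
    have : ε * (|ℓ| + 1) = δ / 2 := by rw [hεdef]; field_simp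
    nlinarith [le_abs_self ℓ]
  obtain ⟨N2, hN2⟩ := eventually_atTop.1 (h2.eventually_lt_const h3)
  refine ⟨max N N2, fun n hn => ?_⟩
  refine lt_of_le_of_lt ?_ (hN2 n (le_of_max_le_right hn))
  have hNn := le_of_max_le_left hn
  rw [Real.dist_eq, sub_zero, abs_div, abs_of_pos (hr0 n), div_le_iff₀ (hr0 n), add_mul, mul_assoc,
    div_mul_cancel₀ _ (hr0 n).ne', Finset.sum_mul]
  have h4 : ∑ i ∈ Finset.range N, a (n - i) / r n * |φ i| * r n =
      ∑ p ∈ Finset.HasAntidiagonal.antidiagonal n, a p.1 * (if p.2 < N then |φ p.2| else 0) := by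
    rw [← Finset.Nat.sum_antidiagonal_swap, Finset.Nat.sum_antidiagonal_eq_sum_range_succ_mk]
    simp only [Prod.swap]
    rw [← Finset.sum_subset (Finset.range_subset_range.2 (by omega : N ≤ n + 1))]
    · refine Finset.sum_congr rfl fun i hi => ?_
      rw [if_pos (Finset.mem_range.1 hi)]
      have := (hr0 n).ne'
      field_simp
    · intro i _ hi
      rw [if_neg (by simpa using hi), mul_zero]
  rw [h4, conv, conv, Finset.mul_sum, ← Finset.sum_add_distrib]
  refine (Finset.abs_sum_le_sum_abs _ _).trans (Finset.sum_le_sum fun p _ => ?_)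
  rw [abs_mul, abs_of_nonneg (ha _)]
  split_ifs with hp
  · have := mul_nonneg hε.le (mul_nonneg (ha p.1) (hh p.2).le)
    linarith
  · have := mul_le_mul_of_nonneg_left (hN' p.2 (by omega)) (ha p.1)
    linarith

/-- Replacing one factor of a convolution by an asymptotically proportional one multiplies the
growth of the convolution by the same constant. -/
theorem tendsto_conv {a ψ h r : ℕ → ℝ} {L ℓ : ℝ} (ha : ∀ n, 0 ≤ a n) (hr0 : ∀ n, 0 < r n)
    (hr : Monotone r) (har : Tendsto (fun n => a n / r n) atTop (𝓝 0)) (hh : ∀ n, 0 < h n)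
    (hψ : Tendsto (fun n => ψ n / h n) atTop (𝓝 L))
    (hl : Tendsto (fun n => conv a h n / r n) atTop (𝓝 ℓ)) :
    Tendsto (fun n => conv a ψ n / r n) atTop
      (𝓝 (L * ℓ)) := by
  have h0 : Tendsto (fun n => (ψ n - L * h n) / h n) atTop (𝓝 0) := by
    have := hψ.sub_const L
    rw [sub_self] at this
    refine this.congr fun n => ?_
    rw [sub_div, mul_div_cancel_right₀ _ (hh n).ne']
  have := (tendsto_conv_zero ha hr0 hr har hh h0 hl).add (hl.const_mul L)
  rw [zero_add] at this
  refine this.congr fun n => ?_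
  rw [← mul_div_assoc, ← add_div, conv, conv, conv, Finset.mul_sum, ← Finset.sum_add_distrib]
  congr 1
  refine Finset.sum_congr rfl fun p _ => by ring

/-! ### The coefficients of `(1 - x) ^ (-α)` -/

theorem multichoose_succ_mul (α : ℝ) (n : ℕ) :
    Ring.multichoose α (n + 1) * (n + 1) = Ring.multichoose α n * (α + n) := by
  have h1 := Ring.factorial_nsmul_multichoose_eq_ascPochhammer α (n + 1)
  have h2 := Ring.factorial_nsmul_multichoose_eq_ascPochhammer α n
  rw [Polynomial.ascPochhammer_smeval_eq_eval, nsmul_eq_mul] at h1 h2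
  rw [ascPochhammer_succ_eval, ← h2, Nat.factorial_succ] at h1
  push_cast at h1
  have : (n.factorial : ℝ) ≠ 0 := by positivity
  apply mul_left_cancel₀ this
  linarith

theorem multichoose_pos {α : ℝ} (hα : 0 < α) (n : ℕ) : 0 < Ring.multichoose α n := by
  induction n with
  | zero => simp
  | succ n ih =>
    have h := multichoose_succ_mul α n
    have : 0 < Ring.multichoose α (n + 1) * (n + 1) := by rw [h]; positivity
    exact pos_of_mul_pos_left this (by positivity)

theorem multichoose_monotone {α : ℝ} (hα : 1 ≤ α) : Monotone (Ring.multichoose α) := by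
  refine monotone_nat_of_le_succ fun n => ?_
  have h := multichoose_succ_mul α n
  have := multichoose_pos (by linarith : 0 < α) n
  have h0 : (0 : ℝ) < n + 1 := by positivity
  refine le_of_mul_le_mul_right ?_ h0
  rw [h]
  exact mul_le_mul_of_nonneg_left (by linarith) this.le

theorem multichoose_add_one (α : ℝ) (n : ℕ) :
    Ring.multichoose (α + 1) n * α = Ring.multichoose α n * (α + n) := by
  induction n with
  | zero => simp
  | succ n ih =>
    have h1 := multichoose_succ_mul (α + 1) n
    have h2 := multichoose_succ_mul α n
    have h0 : (n : ℝ) + 1 ≠ 0 := by positivity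
    apply mul_right_cancel₀ h0
    push_cast
    calc _ = (Ring.multichoose (α + 1) n * α) * (α + 1 + n) := by rw [mul_right_comm, h1]; ring
      _ = (Ring.multichoose α n * (α + n)) * (α + 1 + n) := by rw [ih]
      _ = _ := by rw [← h2]; ring

theorem multichoose_conv (α β : ℝ) (n : ℕ) :
    conv (Ring.multichoose α) (Ring.multichoose β) n = Ring.multichoose (α + β) n := by
  have h := Ring.add_choose_eq n (Commute.all (-α) (-β))
  have key : ∀ (r : ℝ) (k : ℕ), Ring.choose (-r) k = (-1) ^ k * Ring.multichoose r k := by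
    intro r k
    rw [Ring.choose_neg', Units.smul_def, zsmul_eq_mul]
    simp [Int.negOnePow]
  rw [← neg_add, key] at h
  have h2 : ((-1 : ℝ) ^ n) ≠ 0 := by simp
  apply mul_left_cancel₀ h2
  rw [h, conv, Finset.mul_sum]
  refine Finset.sum_congr rfl fun p hp => ?_
  rw [key, key, ← Finset.HasAntidiagonal.mem_antidiagonal.1 hp, pow_add]
  ring

/-! ### Asymptotics of binomial coefficients -/

theorem factorial_eq_stirlingSeq {n : ℕ} (hn : n ≠ 0) :
    (n.factorial : ℝ) = Stirling.stirlingSeq n * (√(2 * n) * (n / Real.exp 1) ^ n) := by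
  have : (0 : ℝ) < n := by positivity
  rw [Stirling.stirlingSeq, div_mul_cancel₀]
  positivity

/-- The reciprocal exponential growth rate of `(M * n).choose n`. -/
def chooseRate (M : ℕ) : ℝ := ((M - 1 : ℕ) : ℝ) ^ (M - 1) / (M : ℝ) ^ M

theorem chooseRate_pos {M : ℕ} (hM : 2 ≤ M) : 0 < chooseRate M := by
  have : 0 < M - 1 := by omega
  unfold chooseRate
  positivity

theorem tendsto_sqrt_mul_choose {M : ℕ} (hM : 2 ≤ M) :
    ∃ C : ℝ, 0 < C ∧ Tendsto (fun n : ℕ => √n * (((M * n).choose n : ℕ) * chooseRate M ^ n))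
      atTop (𝓝 C) := by
  obtain ⟨K, rfl⟩ : ∃ K, M = K + 2 := ⟨M - 2, by omega⟩
  have hpi : 0 < √Real.pi := by positivity
  have hmul : ∀ j : ℕ, 0 < j → Tendsto (fun n : ℕ => Stirling.stirlingSeq (j * n)) atTop
      (𝓝 (√Real.pi)) := fun j hj =>
    Stirling.tendsto_stirlingSeq_sqrt_pi.comp (tendsto_id.const_mul_atTop' hj)
  have h1 := ((hmul (K + 2) (by omega)).div (Stirling.tendsto_stirlingSeq_sqrt_pi.mul
    (hmul (K + 1) (by omega))) (by positivity)).mul_const (√((K + 2) / (2 * (K + 1) : ℝ)))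
  refine ⟨_, by positivity, h1.congr' ?_⟩
  filter_upwards [eventually_ge_atTop 1] with n hn
  have hn0 : (0 : ℝ) < n := by exact_mod_cast hn
  have hc : (((K + 2) * n).choose n : ℝ) =
      ((K + 2) * n).factorial / (n.factorial * ((K + 1) * n).factorial) := by
    have h := Nat.add_choose_mul_factorial_mul_factorial ((K + 1) * n) n
    rw [show (K + 1) * n + n = (K + 2) * n by ring] at h
    rw [eq_div_iff (by positivity), mul_comm (n.factorial : ℝ), ← mul_assoc]
    exact_mod_cast h
  rw [hc, factorial_eq_stirlingSeq (by positivity : (K + 2) * n ≠ 0),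
    factorial_eq_stirlingSeq (by omega : n ≠ 0),
    factorial_eq_stirlingSeq (by positivity : (K + 1) * n ≠ 0)]
  have hs : ∀ j : ℕ, j ≠ 0 → Stirling.stirlingSeq j ≠ 0 := by
    intro j hj
    obtain ⟨i, rfl⟩ := Nat.exists_eq_succ_of_ne_zero hj
    exact (Stirling.stirlingSeq'_pos i).ne'
  simp only [Pi.div_apply]
  have s1 := hs n (by omega)
  have s2 := hs ((K + 1) * n) (by positivity)
  have s3 := hs ((K + 2) * n) (by positivity)
  generalize Stirling.stirlingSeq n = S1 at *
  generalize Stirling.stirlingSeq ((K + 1) * n) = S2 at *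
  generalize Stirling.stirlingSeq ((K + 2) * n) = S3 at *
  have e1 : √((K + 2) / (2 * (K + 1) : ℝ)) * (√(2 * n) * √(2 * ((K + 1 : ℕ) * n : ℕ))) =
      √n * √(2 * ((K + 2 : ℕ) * n : ℕ)) := by
    rw [← Real.sqrt_mul (by positivity), ← Real.sqrt_mul (by positivity),
      ← Real.sqrt_mul (by positivity)]
    congr 1
    push_cast
    field_simp
  have e2 : ((((K + 2) * n : ℕ) : ℝ) / Real.exp 1) ^ ((K + 2) * n) * chooseRate (K + 2) ^ n =
      (n / Real.exp 1) ^ n * ((((K + 1) * n : ℕ) : ℝ) / Real.exp 1) ^ ((K + 1) * n) := by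
    rw [pow_mul, pow_mul, ← mul_pow, ← mul_pow]
    congr 1
    simp only [chooseRate, show K + 2 - 1 = K + 1 by omega]
    push_cast
    simp only [div_pow, mul_pow]
    field_simp
    ring
  have he := Real.exp_pos 1
  generalize hA : √(2 * ((K + 2 : ℕ) * n : ℕ) : ℝ) = A at *
  generalize hB : √(2 * n : ℝ) = B at *
  generalize hD : √(2 * ((K + 1 : ℕ) * n : ℕ) : ℝ) = D at *
  have hB0 : B ≠ 0 := by rw [← hB]; positivity
  have hD0 : D ≠ 0 := by rw [← hD]; positivity
  have hE0 : ((n : ℝ) / Real.exp 1) ^ n ≠ 0 := by positivity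
  have hF0 : ((((K + 1) * n : ℕ) : ℝ) / Real.exp 1) ^ ((K + 1) * n) ≠ 0 := by positivity
  generalize ((((K + 2) * n : ℕ) : ℝ) / Real.exp 1) ^ ((K + 2) * n) = E3 at *
  generalize ((n : ℝ) / Real.exp 1) ^ n = E1 at *
  generalize ((((K + 1) * n : ℕ) : ℝ) / Real.exp 1) ^ ((K + 1) * n) = E2 at *
  field_simp
  calc _ = √((K + 2) / (2 * (K + 1) : ℝ)) * (B * D) * (E1 * E2) := by ring
    _ = _ := by rw [e1, ← e2]; ring

/-- The case `m = 2` of the normalized coefficients `(m * n).choose n`. -/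
theorem multichoose_half (n : ℕ) :
    Ring.multichoose (1 / 2 : ℝ) n = ((2 * n).choose n : ℕ) * chooseRate 2 ^ n := by
  induction n with
  | zero => simp
  | succ n ih =>
    have h1 := multichoose_succ_mul (1 / 2) n
    have h2 := Nat.succ_mul_centralBinom_succ n
    rw [Nat.centralBinom_eq_two_mul_choose, Nat.centralBinom_eq_two_mul_choose] at h2
    have h3 : ((n : ℝ) + 1) * ((2 * (n + 1)).choose (n + 1) : ℕ) =
      2 * (2 * n + 1) * ((2 * n).choose n : ℕ) := by exact_mod_cast h2
    have h0 : (n : ℝ) + 1 ≠ 0 := by positivity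
    apply mul_right_cancel₀ h0
    rw [h1, ih, pow_succ]
    rw [show chooseRate 2 = 1 / 4 by norm_num [chooseRate]]
    linear_combination (-(1 / 4 : ℝ) ^ n * (1 / 4)) * h3

theorem tendsto_multichoose_half : Tendsto (Ring.multichoose (1 / 2 : ℝ)) atTop (𝓝 0) := by
  obtain ⟨C, -, h⟩ := tendsto_sqrt_mul_choose (le_refl 2)
  have h1 : Tendsto (fun n : ℕ => √(n : ℝ)) atTop atTop :=
    Real.tendsto_sqrt_atTop.comp tendsto_natCast_atTop_atTop
  refine (h.div_atTop h1).congr' ?_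
  filter_upwards [eventually_ge_atTop 1] with n hn
  have : 0 < √(n : ℝ) := Real.sqrt_pos.2 (by exact_mod_cast hn)
  rw [multichoose_half, mul_div_cancel_left₀ _ this.ne']

theorem tendsto_choose_div_multichoose_half {m : ℕ} (hm : 2 ≤ m) :
    ∃ C : ℝ, 0 < C ∧ Tendsto (fun n : ℕ => (((m * n).choose n : ℕ) * chooseRate m ^ n) /
      Ring.multichoose (1 / 2 : ℝ) n) atTop (𝓝 C) := by
  obtain ⟨C, hC, h⟩ := tendsto_sqrt_mul_choose hm
  obtain ⟨D, hD, h'⟩ := tendsto_sqrt_mul_choose (le_refl 2)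
  refine ⟨C / D, by positivity, (h.div h' hD.ne').congr' ?_⟩
  filter_upwards [eventually_ge_atTop 1] with n hn
  have : 0 < √(n : ℝ) := Real.sqrt_pos.2 (by exact_mod_cast hn)
  simp only [Pi.div_apply]
  rw [multichoose_half, mul_div_mul_left _ _ this.ne']

/-! ### Renewal weights -/

theorem tendsto_natCast_div_add (α : ℝ) :
    Tendsto (fun n : ℕ => (n : ℝ) / (α + n)) atTop (𝓝 1) := by
  have h1 : Tendsto (fun n : ℕ => α / (n : ℝ) + 1) atTop (𝓝 (0 + 1)) :=
    (tendsto_const_div_atTop_nhds_zero_nat α).add_const 1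
  have h2 := h1.inv₀ (by norm_num)
  norm_num at h2
  refine h2.congr' ?_
  filter_upwards [eventually_ge_atTop 1] with n hn
  have : (n : ℝ) ≠ 0 := by positivity
  rw [div_add_one this, inv_div]

theorem tendsto_multichoose_div_add_one {α : ℝ} (hα : 0 < α) :
    Tendsto (fun n => Ring.multichoose α n / Ring.multichoose (α + 1) n) atTop (𝓝 0) := by
  have h1 : Tendsto (fun n : ℕ => α / (α + (n : ℝ))) atTop (𝓝 0) :=
    tendsto_const_nhds.div_atTop (tendsto_atTop_add_const_left _ _ tendsto_natCast_atTop_atTop)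
  refine h1.congr fun n => ?_
  have h := multichoose_add_one α n
  have h2 := multichoose_pos hα n
  have h3 := multichoose_pos (by linarith : 0 < α + 1) n
  rw [div_eq_div_iff (by positivity) h3.ne']
  linarith

/-- The product of `i + 1 / 2` over `i < b`, which is the limit of
`n ^ b * multichoose (1 / 2) n / multichoose (b + 1 / 2) n` as `n → ∞`. -/
def halfProd (b : ℕ) : ℝ := ∏ i ∈ Finset.range b, ((i : ℝ) + 1 / 2)

theorem halfProd_pos (b : ℕ) : 0 < halfProd b := Finset.prod_pos fun i _ => by positivity

theorem tendsto_pow_mul_multichoose_half (b : ℕ) :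
    Tendsto (fun n : ℕ => (n : ℝ) ^ b * Ring.multichoose (1 / 2 : ℝ) n /
      Ring.multichoose ((b : ℝ) + 1 / 2) n) atTop (𝓝 (halfProd b)) := by
  induction b with
  | zero =>
    simp only [halfProd, Finset.range_zero, Finset.prod_empty]
    refine tendsto_const_nhds.congr fun n => ?_
    have := multichoose_pos (by norm_num : (0 : ℝ) < 1 / 2) n
    simp only [pow_zero, one_mul, Nat.cast_zero, zero_add]
    rw [div_self this.ne']
  | succ b ih =>
    have h := (ih.mul_const ((b : ℝ) + 1 / 2)).mul (tendsto_natCast_div_add ((b : ℝ) + 1 / 2))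
    rw [mul_one] at h
    rw [halfProd, Finset.prod_range_succ]
    refine h.congr fun n => ?_
    have h0 := multichoose_pos (by positivity : (0 : ℝ) < b + 1 / 2) n
    have h2 := multichoose_pos (by positivity : (0 : ℝ) < b + 1 / 2 + 1) n
    have h1 := multichoose_add_one ((b : ℝ) + 1 / 2) n
    rw [show ((b + 1 : ℕ) : ℝ) + 1 / 2 = b + 1 / 2 + 1 by push_cast; ring]
    generalize Ring.multichoose ((b : ℝ) + 1 / 2 + 1) n = x at *
    generalize Ring.multichoose ((b : ℝ) + 1 / 2) n = y at *
    generalize Ring.multichoose (1 / 2 : ℝ) n = z at *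
    rw [div_mul_eq_mul_div, div_mul_div_comm, div_eq_div_iff (by positivity) (by positivity)]
    linear_combination (n : ℝ) ^ b * z * n * h1

theorem div_mul_mul_div_cancel {x y z p : ℝ} (hy : 0 < y) : x / y * (p * y / z) = p * x / z := by
  have := hy.ne'
  rw [div_mul_div_comm, mul_left_comm, ← mul_assoc, mul_comm y z, mul_div_mul_right _ _ this]

theorem monotone_succ_cast : Monotone fun n : ℕ => (n : ℝ) + 1 :=
  fun _ _ h => by simpa using h

/-- If `n ζ n = ∑ a k ζ (n - k)` with `a ≥ 0` and `ζ n` is proportional to `n ^ (-1/2)`, then the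
partial sums of `a` grow like `n / 2`. The hypothesis is convolved with the coefficients of
`(1 - x) ^ (-1/2)`, whose convolution square is constant. -/
theorem tendsto_conv_one {a ζ : ℕ → ℝ} {C : ℝ} (hC : 0 < C) (ha : ∀ n, 0 ≤ a n)
    (hζ : ∀ n, 0 < ζ n) (hlim : Tendsto (fun n => ζ n / Ring.multichoose (1 / 2 : ℝ) n) atTop (𝓝 C))
    (hconv : ∀ n, conv a ζ n = n * ζ n) (ha1 : Tendsto (fun n => a n / (n + 1)) atTop (𝓝 0)) :
    Tendsto (fun n => conv a (fun _ => 1) n / (n + 1)) atTop (𝓝 (1 / 2)) := by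
  set η : ℕ → ℝ := Ring.multichoose (1 / 2 : ℝ) with hη
  have hη0 : ∀ n, 0 < η n := multichoose_pos (by norm_num)
  have hηη : conv η η = fun _ => 1 := by
    funext n
    rw [multichoose_conv]
    norm_num
  have hg : Tendsto (conv η ζ) atTop (𝓝 C) := by
    have := tendsto_conv (r := fun _ => 1) (ℓ := 1) (fun n => (hη0 n).le) (fun _ => one_pos)
      monotone_const (by simpa only [div_one] using tendsto_multichoose_half) hη0 hlim (by simp [hηη])
    simpa using this
  have hg0 : ∀ n, 0 < conv η ζ n := by
    intro n
    refine Finset.sum_pos (fun p _ => mul_pos (hη0 _) (hζ _)) ⟨(0, n), ?_⟩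
    simp [Finset.HasAntidiagonal.mem_antidiagonal]
  have h32 : Tendsto (fun n : ℕ => (n : ℝ) * ζ n / Ring.multichoose (3 / 2 : ℝ) n) atTop
      (𝓝 (C * (1 / 2))) := by
    have h := hlim.mul (tendsto_pow_mul_multichoose_half 1)
    have e : halfProd 1 = 1 / 2 := by simp [halfProd]
    have e2 : ((1 : ℕ) : ℝ) + 1 / 2 = 3 / 2 := by norm_num
    rw [e, e2] at h
    refine h.congr fun n => ?_
    rw [div_mul_mul_div_cancel (hη0 n), pow_one]
  have h2 : Tendsto (fun n => conv a (conv η ζ) n / (n + 1)) atTop (𝓝 (C * (1 / 2) * 1)) := by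
    have e : conv a (conv η ζ) = conv η (fun n => n * ζ n) := by
      rw [← funext hconv, ← conv_assoc, ← conv_assoc, conv_comm a]
    rw [e]
    refine tendsto_conv (fun n => (hη0 n).le) (fun n => by positivity) monotone_succ_cast
      ?_ (multichoose_pos (by norm_num : (0 : ℝ) < 3 / 2)) h32 ?_
    · exact tendsto_multichoose_half.div_atTop
        (tendsto_atTop_add_const_right _ _ tendsto_natCast_atTop_atTop)
    · refine tendsto_const_nhds.congr fun n => ?_
      rw [multichoose_conv, show (1 / 2 + 3 / 2 : ℝ) = 2 by norm_num, Ring.multichoose_two,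
        div_self (by positivity)]
  have h3 : Tendsto (fun n => (fun _ => (1 : ℝ)) n / conv η ζ n) atTop (𝓝 (1 / C)) :=
    tendsto_const_nhds.div hg hC.ne'
  have := tendsto_conv ha (fun n => by positivity) monotone_succ_cast ha1 hg0 h3 h2
  convert this using 2
  field_simp

/-- The moments of the renewal-type weights `a k ζ (n - k) / (n ζ n)` under `k ↦ (n - k) / n`
converge to those of the square of a uniform variable. -/
theorem tendsto_renewal_moment {a ζ : ℕ → ℝ} {C : ℝ} (hC : 0 < C) (ha : ∀ n, 0 ≤ a n)
    (hζ : ∀ n, 0 < ζ n) (hlim : Tendsto (fun n => ζ n / Ring.multichoose (1 / 2 : ℝ) n) atTop (𝓝 C))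
    (hconv : ∀ n, conv a ζ n = n * ζ n) (b : ℕ) :
    Tendsto (fun n : ℕ => conv a (fun j => (j : ℝ) ^ b * ζ j) n / ((n : ℝ) ^ (b + 1) * ζ n)) atTop
      (𝓝 (1 / (2 * b + 1))) := by
  rcases Nat.eq_zero_or_pos b with rfl | hb
  · norm_num
    refine tendsto_const_nhds.congr' ?_
    filter_upwards [eventually_ge_atTop 1] with n hn
    have h1 : (n : ℝ) ≠ 0 := by positivity
    rw [hconv, div_self (mul_ne_zero h1 (hζ n).ne')]
  obtain ⟨c, rfl⟩ : ∃ c, b = c + 1 := ⟨b - 1, by omega⟩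
  have hη0 : ∀ n, 0 < Ring.multichoose (1 / 2 : ℝ) n := multichoose_pos (by norm_num)
  have hale : ∀ n, a n ≤ n * ζ n / ζ 0 := by
    intro n
    rw [le_div_iff₀ (hζ 0), ← hconv]
    exact Finset.single_le_sum (f := fun p : ℕ × ℕ => a p.1 * ζ p.2)
      (a := (n, 0))
      (fun p _ => mul_nonneg (ha _) (hζ _).le)
      (Finset.HasAntidiagonal.mem_antidiagonal.2 (show ((n, 0) : ℕ × ℕ).1 + (n, 0).2 = n from add_zero n))
  have hζ0 : Tendsto ζ atTop (𝓝 0) := by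
    have := hlim.mul tendsto_multichoose_half
    rw [mul_zero] at this
    exact this.congr fun n => div_mul_cancel₀ _ (hη0 n).ne'
  have ha1 : Tendsto (fun n => a n / (n + 1)) atTop (𝓝 0) := by
    refine squeeze_zero (fun n => div_nonneg (ha n) (by positivity)) (fun n => ?_)
      (by simpa using hζ0.div_const (ζ 0))
    rw [div_le_iff₀ (by positivity)]
    refine (hale n).trans ?_
    rw [div_mul_eq_mul_div]
    refine div_le_div_of_nonneg_right ?_ (hζ 0).le
    nlinarith [hζ n]
  have h1 := tendsto_conv_one hC ha hζ hlim hconv ha1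
  have p1 : (0 : ℝ) < c + 1 / 2 := by positivity
  have p2 : (0 : ℝ) < c + 1 / 2 + 1 := by positivity
  have p3 : (0 : ℝ) < c + 1 / 2 + 2 := by positivity
  have hr : Monotone (Ring.multichoose ((c : ℝ) + 1 / 2 + 2)) :=
    multichoose_monotone (by linarith)
  have hA : Tendsto (fun n => conv a (Ring.multichoose ((c : ℝ) + 1 / 2 + 1)) n /
      Ring.multichoose ((c : ℝ) + 1 / 2 + 2) n) atTop (𝓝 (1 / 2 * 1)) := by
    have e : conv a (Ring.multichoose ((c : ℝ) + 1 / 2 + 1)) =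
        conv (Ring.multichoose ((c : ℝ) + 1 / 2)) (conv a fun _ => 1) := by
      have h11 : (fun _ : ℕ => (1 : ℝ)) = Ring.multichoose (1 : ℝ) := by
        funext n; rw [Ring.multichoose_one]
      rw [conv_comm _ (conv a _), conv_assoc, h11, conv_comm (Ring.multichoose 1),
        ← funext (multichoose_conv ((c : ℝ) + 1 / 2) 1)]
    rw [e]
    refine tendsto_conv (h := Ring.multichoose 2) (fun n => (multichoose_pos p1 n).le)
      (multichoose_pos p3) hr ?_ (multichoose_pos two_pos) ?_ ?_
    · have := (tendsto_multichoose_div_add_one p1).mul (tendsto_multichoose_div_add_one p2)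
      rw [mul_zero] at this
      refine this.congr fun n => ?_
      rw [div_mul_div_cancel₀ (multichoose_pos p2 n).ne',
        show (c : ℝ) + 1 / 2 + 1 + 1 = c + 1 / 2 + 2 by ring]
    · simpa only [Ring.multichoose_two] using h1
    · refine tendsto_const_nhds.congr fun n => ?_
      rw [multichoose_conv, div_self (multichoose_pos p3 n).ne']
  have q1 : ((c + 1 : ℕ) : ℝ) + 1 / 2 = c + 1 / 2 + 1 := by push_cast; ring
  have q2 : ((c + 1 + 1 : ℕ) : ℝ) + 1 / 2 = c + 1 / 2 + 2 := by push_cast; ring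
  have hL1 := tendsto_pow_mul_multichoose_half (c + 1)
  have hL2 := tendsto_pow_mul_multichoose_half (c + 1 + 1)
  rw [q1] at hL1
  rw [q2] at hL2
  have hψ : Tendsto (fun n : ℕ => (n : ℝ) ^ (c + 1) * ζ n /
      Ring.multichoose ((c : ℝ) + 1 / 2 + 1) n) atTop (𝓝 (C * halfProd (c + 1))) := by
    refine (hlim.mul hL1).congr fun n => ?_
    exact div_mul_mul_div_cancel (hη0 n)
  have haR : Tendsto (fun n => a n / Ring.multichoose ((c : ℝ) + 1 / 2 + 2) n) atTop (𝓝 0) := by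
    have hz : Tendsto (fun n : ℕ => ζ n / Ring.multichoose (1 / 2 : ℝ) n *
        ((n : ℝ) ^ (c + 1 + 1) * Ring.multichoose (1 / 2 : ℝ) n /
          Ring.multichoose ((c : ℝ) + 1 / 2 + 2) n) * ((n : ℝ) ^ (c + 1))⁻¹ / ζ 0) atTop
        (𝓝 (C * halfProd (c + 1 + 1) * 0 / ζ 0)) := by
      refine ((hlim.mul hL2).mul ?_).div_const _
      exact (tendsto_inv_atTop_zero.comp
        ((tendsto_pow_atTop (by omega : c + 1 ≠ 0)).comp tendsto_natCast_atTop_atTop))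
    rw [mul_zero, zero_div] at hz
    refine squeeze_zero' (Eventually.of_forall fun n => div_nonneg (ha n)
      (multichoose_pos p3 n).le) ?_ hz
    filter_upwards [eventually_ge_atTop 1] with n hn
    have hn0 : (n : ℝ) ≠ 0 := by positivity
    have e0 := hη0 n
    have e3 := multichoose_pos p3 n
    rw [div_le_iff₀ e3]
    refine (hale n).trans (le_of_eq ?_)
    have := (hζ 0).ne'
    rw [div_mul_mul_div_cancel e0, pow_succ' _ (c + 1)]
    generalize Ring.multichoose ((c : ℝ) + 1 / 2 + 2) n = x at *
    field_simp
  have hmain := tendsto_conv ha (multichoose_pos p3) hr haR (multichoose_pos p2) hψ hA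
  have hden : Tendsto (fun n : ℕ => (n : ℝ) ^ (c + 1 + 1) * ζ n /
      Ring.multichoose ((c : ℝ) + 1 / 2 + 2) n) atTop (𝓝 (C * halfProd (c + 1 + 1))) := by
    refine (hlim.mul hL2).congr fun n => ?_
    exact div_mul_mul_div_cancel (hη0 n)
  have hne : C * halfProd (c + 1 + 1) ≠ 0 := (mul_pos hC (halfProd_pos _)).ne'
  have := hmain.div hden hne
  have hval : C * halfProd (c + 1) * (1 / 2 * 1) / (C * halfProd (c + 1 + 1)) =
      1 / (2 * ((c + 1 : ℕ) : ℝ) + 1) := by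
    have h0 := halfProd_pos (c + 1)
    have h2 : halfProd (c + 1 + 1) = halfProd (c + 1) * (((c + 1 : ℕ) : ℝ) + 1 / 2) :=
      Finset.prod_range_succ _ _
    rw [h2, mul_one]
    push_cast
    field_simp
  rw [hval] at this
  refine this.congr fun n => ?_
  simp only [Pi.div_apply]
  rw [div_div_div_cancel_right₀ (multichoose_pos p3 n).ne']

/-! ### Limits of first-block recursions -/

open Finset.HasAntidiagonal (antidiagonal)

section Recursion

variable {q : ℕ → ℕ × ℕ → ℝ}

theorem cast_div_mem {n k l : ℕ} (h : (k, l) ∈ antidiagonal n) :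
    (0 ≤ (k : ℝ) / n ∧ (k : ℝ) / n ≤ 1) ∧ (0 ≤ (l : ℝ) / n ∧ (l : ℝ) / n ≤ 1) := by
  have h : k + l = n := Finset.HasAntidiagonal.mem_antidiagonal.1 h
  refine ⟨⟨by positivity, div_le_one_of_le₀ (by exact_mod_cast by omega) (by positivity)⟩,
    ⟨by positivity, div_le_one_of_le₀ (by exact_mod_cast by omega) (by positivity)⟩⟩

/-- An eventual bound on `u` controls its weighted means: the factor `(l / n) ^ b` makes the small
indices `l`, where the bound on `u` may fail, negligible. -/
theorem eventually_weighted_lt (hq0 : ∀ n p, 0 ≤ q n p) {M : ℕ → ℝ}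
    (hq : ∀ b, Tendsto (fun n : ℕ => ∑ p ∈ antidiagonal n, q n p * ((p.2 : ℝ) / n) ^ b) atTop
      (𝓝 (M b))) {b : ℕ} (hb : b ≠ 0) {u : ℕ → ℝ} (hu0 : ∀ n, 0 ≤ u n) {K δ : ℝ}
    (huK : ∀ n, u n ≤ K) (hδ : ∀ᶠ n in atTop, u n ≤ δ) (hδ0 : 0 ≤ δ) {c : ℝ} (hc : δ * M b < c) :
    ∀ᶠ n : ℕ in atTop, ∑ p ∈ antidiagonal n, q n p * ((p.2 : ℝ) / n) ^ b * u p.2 < c := by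
  obtain ⟨N, hN⟩ := eventually_atTop.1 hδ
  have hK : 0 ≤ K := (hu0 0).trans (huK 0)
  have h1 : Tendsto (fun n : ℕ => ((N : ℝ) / n) ^ b * K) atTop (𝓝 (0 ^ b * K)) :=
    ((tendsto_const_div_atTop_nhds_zero_nat (N : ℝ)).pow b).mul_const K
  rw [zero_pow hb, zero_mul] at h1
  have h2 := ((hq b).const_mul δ).add ((hq 0).mul h1)
  rw [mul_zero, add_zero] at h2
  filter_upwards [h2.eventually_lt_const hc] with n hn
  refine lt_of_le_of_lt ?_ hn
  rw [Finset.mul_sum, Finset.sum_mul, ← Finset.sum_add_distrib]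
  refine Finset.sum_le_sum fun p hp => ?_
  obtain ⟨-, hy0, hy1⟩ := cast_div_mem (k := p.1) (l := p.2) hp
  rw [pow_zero, mul_one]
  have hqp := hq0 n p
  have hyb : 0 ≤ ((p.2 : ℝ) / n) ^ b := pow_nonneg hy0 b
  have hNb : 0 ≤ ((N : ℝ) / n) ^ b := by positivity
  rcases le_or_gt N p.2 with h | h
  · have h3 := mul_le_mul_of_nonneg_left (hN p.2 h) (mul_nonneg hqp hyb)
    have h4 : 0 ≤ q n p * (((N : ℝ) / n) ^ b * K) := by positivity
    linarith
  · have h3 : ((p.2 : ℝ) / n) ^ b ≤ ((N : ℝ) / n) ^ b := by gcongr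
    have h4 : q n p * ((p.2 : ℝ) / n) ^ b * u p.2 ≤ q n p * (((N : ℝ) / n) ^ b * K) := by
      rw [mul_assoc]
      refine mul_le_mul_of_nonneg_left ?_ hqp
      exact mul_le_mul h3 (huK _) (hu0 _) hNb
    have h5 : 0 ≤ δ * (q n p * ((p.2 : ℝ) / n) ^ b) := by positivity
    linarith

/-- Convergence of the moments of `l / n` gives that of the mixed moments of `k / n = 1 - l / n` and
`l / n`. -/
theorem tendsto_mixed_moment {M : ℕ → ℕ → ℝ}
    (hM : ∀ a b, M (a + 1) b = M a b - M a (b + 1))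
    (hq : ∀ b, Tendsto (fun n : ℕ => ∑ p ∈ antidiagonal n, q n p * ((p.2 : ℝ) / n) ^ b) atTop
      (𝓝 (M 0 b))) (a : ℕ) : ∀ b,
    Tendsto (fun n : ℕ => ∑ p ∈ antidiagonal n,
      q n p * (((p.1 : ℝ) / n) ^ a * ((p.2 : ℝ) / n) ^ b)) atTop (𝓝 (M a b)) := by
  induction a with
  | zero => simpa using hq
  | succ a ih =>
    intro b
    rw [hM]
    refine ((ih b).sub (ih (b + 1))).congr' ?_
    filter_upwards [eventually_ge_atTop 1] with n hn
    rw [← Finset.sum_sub_distrib]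
    refine Finset.sum_congr rfl fun p hp => ?_
    have h : p.1 + p.2 = n := Finset.HasAntidiagonal.mem_antidiagonal.1 hp
    have hn0 : (n : ℝ) ≠ 0 := by positivity
    have : (p.1 : ℝ) / n = 1 - (p.2 : ℝ) / n := by
      rw [eq_sub_iff_add_eq, ← add_div, div_eq_one_iff_eq hn0]
      exact_mod_cast h
    rw [this]
    ring

/-- A bounded solution of the recursion `Φ n = ∑ q (l / n) ^ b Φ l + e n`, whose operator part is
asymptotically a contraction, converges to the solution of the limiting equation. -/
theorem tendsto_of_contraction (hq0 : ∀ n p, 0 ≤ q n p) {M : ℕ → ℝ}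
    (hq : ∀ b, Tendsto (fun n : ℕ => ∑ p ∈ antidiagonal n, q n p * ((p.2 : ℝ) / n) ^ b) atTop
      (𝓝 (M b))) {b : ℕ} (hb : b ≠ 0) (hM1 : M b < 1) {Φ e : ℕ → ℝ} {E Ψ : ℝ}
    (hΦ : ∀ n, |Φ n| ≤ 1) (he : Tendsto e atTop (𝓝 E)) (hΨ : Ψ = M b * Ψ + E)
    (hrec : ∀ n, 1 ≤ n →
      Φ n = ∑ p ∈ antidiagonal n, q n p * ((p.2 : ℝ) / n) ^ b * Φ p.2 + e n) :
    Tendsto Φ atTop (𝓝 Ψ) := by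
  have hM0 : 0 ≤ M b := ge_of_tendsto' (hq b) fun n =>
    Finset.sum_nonneg fun p _ => mul_nonneg (hq0 _ _) (by positivity)
  set u : ℕ → ℝ := fun n => |Φ n - Ψ| with hu
  have huK : ∀ n, u n ≤ 1 + |Ψ| := fun n => (abs_sub _ _).trans (by linarith [hΦ n])
  set f : ℕ → ℝ := fun n =>
    |e n - E + Ψ * (∑ p ∈ antidiagonal n, q n p * ((p.2 : ℝ) / n) ^ b - M b)| with hf
  have hf0 : Tendsto f atTop (𝓝 0) := by
    have := ((he.sub_const E).add (((hq b).sub_const (M b)).const_mul Ψ)).abs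
    simpa using this
  have hstep : ∀ n, 1 ≤ n →
      u n ≤ ∑ p ∈ antidiagonal n, q n p * ((p.2 : ℝ) / n) ^ b * u p.2 + f n := by
    intro n hn
    have h1 : Φ n - Ψ = ∑ p ∈ antidiagonal n, q n p * ((p.2 : ℝ) / n) ^ b * (Φ p.2 - Ψ) +
        (e n - E + Ψ * (∑ p ∈ antidiagonal n, q n p * ((p.2 : ℝ) / n) ^ b - M b)) := by
      simp only [mul_sub]
      rw [Finset.sum_sub_distrib, ← Finset.sum_mul, hrec n hn]
      linear_combination -hΨ
    rw [hu, hf]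
    simp only
    rw [h1]
    refine (abs_add_le _ _).trans (add_le_add_left ?_ _)
    refine (Finset.abs_sum_le_sum_abs _ _).trans (Finset.sum_le_sum fun p _ => ?_)
    rw [abs_mul, abs_of_nonneg (mul_nonneg (hq0 _ _) (by positivity))]
  -- each pass through the recursion improves the eventual bound by the factor `ρ < 1`
  set ρ := (1 + M b) / 2 with hρ
  have hρ1 : ρ < 1 := by rw [hρ]; linarith
  have hρ0 : 0 < ρ := by rw [hρ]; linarith
  have hit : ∀ j : ℕ, ∀ᶠ n in atTop, u n ≤ (1 + |Ψ|) * ρ ^ j := by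
    intro j
    induction j with
    | zero => exact Eventually.of_forall fun n => by simpa using huK n
    | succ j ih =>
      have hδ : 0 < (1 + |Ψ|) * ρ ^ j := by positivity
      set δ := (1 + |Ψ|) * ρ ^ j
      have hc : δ * M b < δ * ((1 + 3 * M b) / 4) := by
        apply mul_lt_mul_of_pos_left _ hδ
        linarith
      have h1 := eventually_weighted_lt hq0 hq hb (fun n => abs_nonneg (Φ n - Ψ)) huK ih hδ.le hc
      have h2 := hf0.eventually_lt_const (show 0 < δ * ((1 - M b) / 4) by
        apply mul_pos hδ; linarith)
      filter_upwards [h1, h2, eventually_ge_atTop 1] with n h1 h2 hn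
      have h3 := hstep n hn
      have : (1 + |Ψ|) * ρ ^ (j + 1) = δ * ((1 + 3 * M b) / 4) + δ * ((1 - M b) / 4) := by
        rw [pow_succ, ← mul_assoc]
        change δ * ρ = _
        rw [hρ]
        ring
      rw [this]
      linarith
  rw [tendsto_iff_norm_sub_tendsto_zero]
  refine tendsto_order.2 ⟨fun c hc => Eventually.of_forall fun n => hc.trans_le (norm_nonneg _),
    fun c hc => ?_⟩
  have h1 : Tendsto (fun j : ℕ => (1 + |Ψ|) * ρ ^ j) atTop (𝓝 ((1 + |Ψ|) * 0)) :=
    (tendsto_pow_atTop_nhds_zero_of_lt_one hρ0.le hρ1).const_mul _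
  rw [mul_zero] at h1
  obtain ⟨j, hj⟩ := (h1.eventually_lt_const hc).exists
  filter_upwards [hit j] with n hn
  rw [Real.norm_eq_abs]
  exact hn.trans_lt hj

variable {ι : Type*} [DecidableEq ι]

/-- The first-block recursion for mixed moments passes to the limit. -/
theorem tendsto_of_block_recursion (hq0 : ∀ n p, 0 ≤ q n p) {M : ℕ → ℕ → ℝ}
    (hM : ∀ a b, M (a + 1) b = M a b - M a (b + 1)) (hM1 : ∀ b, b ≠ 0 → M 0 b < 1)
    (hq : ∀ b, Tendsto (fun n : ℕ => ∑ p ∈ antidiagonal n, q n p * ((p.2 : ℝ) / n) ^ b) atTop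
      (𝓝 (M 0 b))) {J : ι → ℕ} (hJ : ∀ i, J i ≠ 0) {Φ : Finset ι → ℕ → ℝ} {Ψ : Finset ι → ℝ}
    (hΦ : ∀ s n, |Φ s n| ≤ 1) (hΦ0 : ∀ n, Φ ∅ n = 1) (hΨ0 : Ψ ∅ = 1)
    (hΦrec : ∀ s n, 1 ≤ n → Φ s n = ∑ p ∈ antidiagonal n, q n p * ∑ t ∈ s.powerset,
      ((p.1 : ℝ) / n) ^ (∑ i ∈ t, J i) * ((p.2 : ℝ) / n) ^ (∑ i ∈ s \ t, J i) * Φ (s \ t) p.2)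
    (hΨrec : ∀ s, Ψ s = ∑ t ∈ s.powerset, M (∑ i ∈ t, J i) (∑ i ∈ s \ t, J i) * Ψ (s \ t))
    (s : Finset ι) : Tendsto (Φ s) atTop (𝓝 (Ψ s)) := by
  have hJs : ∀ s : Finset ι, s.Nonempty → ∑ i ∈ s, J i ≠ 0 := by
    rintro s ⟨i, hi⟩ h
    exact hJ i (Finset.sum_eq_zero_iff.1 h i hi)
  induction s using Finset.strongInduction with
  | H s ih =>
    rcases s.eq_empty_or_nonempty with rfl | hs
    · rw [hΨ0]
      exact tendsto_const_nhds.congr fun n => (hΦ0 n).symm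
    have hterm : ∀ t ∈ s.powerset.erase ∅, Tendsto (fun n : ℕ => ∑ p ∈ antidiagonal n,
        q n p * (((p.1 : ℝ) / n) ^ (∑ i ∈ t, J i) * ((p.2 : ℝ) / n) ^ (∑ i ∈ s \ t, J i)
          * Φ (s \ t) p.2)) atTop (𝓝 (M (∑ i ∈ t, J i) (∑ i ∈ s \ t, J i) * Ψ (s \ t))) := by
      intro t ht
      rw [Finset.mem_erase, Finset.mem_powerset] at ht
      have hmix := tendsto_mixed_moment hM hq (∑ i ∈ t, J i) (∑ i ∈ s \ t, J i)
      rcases (s \ t).eq_empty_or_nonempty with he | hne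
      · rw [he] at hmix ⊢
        simpa [hΦ0, hΨ0] using hmix
      have hlim := ih (s \ t) (Finset.sdiff_ssubset ht.2 (Finset.nonempty_iff_ne_empty.2 ht.1))
      have herr : Tendsto (fun n : ℕ => ∑ p ∈ antidiagonal n,
          q n p * (((p.1 : ℝ) / n) ^ (∑ i ∈ t, J i) * ((p.2 : ℝ) / n) ^ (∑ i ∈ s \ t, J i)
          * (Φ (s \ t) p.2 - Ψ (s \ t)))) atTop (𝓝 0) := by
        rw [tendsto_zero_iff_abs_tendsto_zero]
        have hd : Tendsto (fun n => |Φ (s \ t) n - Ψ (s \ t)|) atTop (𝓝 0) := by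
          simpa using (hlim.sub_const (Ψ (s \ t))).abs
        refine tendsto_order.2 ⟨fun c hc => Eventually.of_forall fun n =>
          hc.trans_le (abs_nonneg _), fun c hc => ?_⟩
        have hMb : 0 ≤ M 0 (∑ i ∈ s \ t, J i) := ge_of_tendsto' (hq _) fun n =>
          Finset.sum_nonneg fun p _ => mul_nonneg (hq0 _ _) (by positivity)
        have hc' : c / (2 * (M 0 (∑ i ∈ s \ t, J i) + 1)) * M 0 (∑ i ∈ s \ t, J i) < c := by
          rw [div_mul_eq_mul_div, div_lt_iff₀ (by positivity)]
          nlinarith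
        have := eventually_weighted_lt hq0 hq (hJs _ hne)
          (fun n => abs_nonneg (Φ (s \ t) n - Ψ (s \ t)))
          (K := 1 + |Ψ (s \ t)|) (fun n => (abs_sub _ _).trans (by linarith [hΦ (s \ t) n]))
          (hd.eventually_le_const (show 0 < c / (2 * (M 0 (∑ i ∈ s \ t, J i) + 1)) by positivity))
          (by positivity) hc'
        filter_upwards [this] with n hn
        refine lt_of_le_of_lt ?_ hn
        refine (Finset.abs_sum_le_sum_abs _ _).trans (Finset.sum_le_sum fun p hp => ?_)
        obtain ⟨⟨hx0, hx1⟩, hy0, hy1⟩ := cast_div_mem (k := p.1) (l := p.2) hp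
        have hx : ((p.1 : ℝ) / n) ^ (∑ i ∈ t, J i) ≤ 1 := pow_le_one₀ hx0 hx1
        rw [abs_mul, abs_mul, abs_mul, abs_of_nonneg (hq0 n p), abs_of_nonneg (pow_nonneg hx0 _),
          abs_of_nonneg (pow_nonneg hy0 _), mul_assoc (q n p)]
        refine mul_le_mul_of_nonneg_left ?_ (hq0 _ _)
        refine mul_le_mul_of_nonneg_right ?_ (abs_nonneg _)
        exact mul_le_of_le_one_left (pow_nonneg hy0 _) hx
      have := herr.add (hmix.mul_const (Ψ (s \ t)))
      rw [zero_add] at this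
      refine this.congr fun n => ?_
      rw [Finset.sum_mul, ← Finset.sum_add_distrib]
      refine Finset.sum_congr rfl fun p _ => by ring
    refine tendsto_of_contraction hq0 hq (hJs s hs) (hM1 _ (hJs s hs)) (hΦ s)
      (tendsto_finsetSum _ hterm) ?_ fun n hn => ?_
    · conv_lhs => rw [hΨrec, ← Finset.add_sum_erase _ _ (Finset.empty_mem_powerset s)]
      simp
    · rw [hΦrec s n hn, Finset.sum_comm, ← Finset.sum_add_distrib]
      refine Finset.sum_congr rfl fun p _ => ?_
      rw [← Finset.add_sum_erase _ _ (Finset.empty_mem_powerset s), mul_add, Finset.mul_sum]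
      simp [mul_assoc]

end Recursion

/-! ### Ranking and power sums -/

section RankedPow

variable {ι : Type*} {x : ι → ℝ}

theorem ranked_pow (h0 : ∀ i, 0 ≤ x i) (h1 : ∀ i, x i ≤ 1) {j : ℕ} (hj : j ≠ 0) (k : ℕ) :
    ranked (fun i => x i ^ j) k = ranked x k ^ j := by
  have h1' : ∀ i, x i ^ j ≤ 1 := fun i => pow_le_one₀ (h0 i) (h1 i)
  refine le_antisymm ?_ ?_
  · refine le_of_forall_lt fun a ha => ?_
    rcases lt_or_ge a 0 with h | h
    · exact h.trans_le (pow_nonneg (ranked_nonneg h1 k) j)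
    rcases (lt_ranked_iff h1' k a).1 ha with h' | ⟨s, hs, h'⟩
    · exact absurd h' (not_lt.2 h)
    have hne : s.Nonempty := Finset.card_pos.1 (by omega)
    obtain ⟨i, hi, hmin⟩ := s.exists_min_image x hne
    refine (h' i hi).trans_le (pow_le_pow_left₀ (h0 i) ?_ j)
    exact le_csSup (bddAbove_rankedSet h1 k) (Or.inr ⟨s, hs, hmin⟩)
  · refine le_of_forall_lt fun a ha => ?_
    rcases lt_or_ge a 0 with h | h
    · exact h.trans_le (ranked_nonneg h1' k)
    have hr : 0 < ranked x k := by
      rcases (ranked_nonneg h1 k).eq_or_lt with h' | h'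
      · rw [← h', zero_pow hj] at ha; linarith
      · exact h'
    -- an intermediate level between the `j`-th root of `a` and the ranked term
    obtain ⟨b, hb0, hba, hbr⟩ : ∃ b, 0 ≤ b ∧ a < b ^ j ∧ b < ranked x k := by
      have hc : ContinuousWithinAt (fun b : ℝ => b ^ j) (Set.Iio (ranked x k)) (ranked x k) :=
        (continuous_pow j).continuousWithinAt
      have h2 := hc.eventually (lt_mem_nhds ha)
      obtain ⟨b, ⟨hb, hb'⟩, hb''⟩ := ((h2.and self_mem_nhdsWithin).and
        (mem_nhdsWithin_of_mem_nhds (lt_mem_nhds hr))).exists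
      exact ⟨b, hb''.le, hb, hb'⟩
    rcases (lt_ranked_iff h1 k b).1 hbr with h' | ⟨s, hs, h'⟩
    · linarith
    exact (lt_ranked_iff h1' k a).2 (Or.inr ⟨s, hs, fun i hi =>
      hba.trans_le (pow_le_pow_left₀ hb0 (h' i hi).le j)⟩)

/-- A term which is minimal among `n + 1` terms is at most the `(n + 1)`-st largest one. -/
theorem sum_le_sum_ranked (h1 : ∀ i, x i ≤ 1) : ∀ (n : ℕ) (s : Finset ι), s.card = n →
    ∑ i ∈ s, x i ≤ ∑ k ∈ Finset.range n, ranked x k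
  | 0, s, hs => by simp [Finset.card_eq_zero.1 hs]
  | n + 1, s, hs => by
    classical
    obtain ⟨i, hi, hmin⟩ := s.exists_min_image x (Finset.card_pos.1 (by omega))
    rw [Finset.sum_range_succ, ← Finset.sum_erase_add _ _ hi]
    refine add_le_add (sum_le_sum_ranked h1 n _ (by rw [Finset.card_erase_of_mem hi]; omega)) ?_
    exact le_csSup (bddAbove_rankedSet h1 n) (Or.inr ⟨s, hs, hmin⟩)

theorem sum_ranked_le_of_sum_le (h0 : ∀ i, 0 ≤ x i) {A : ℝ}
    (hA : ∀ s : Finset ι, ∑ i ∈ s, x i ≤ A) (n : ℕ) : ∑ k ∈ Finset.range n, ranked x k ≤ A := by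
  refine le_of_forall_pos_le_add fun ε hε => ?_
  have hδ : 0 < ε / (n + 1) := by positivity
  have hex : ∀ k, ∃ t ∈ rankedSet x k, ranked x k - ε / (n + 1) < t := fun k =>
    exists_lt_of_lt_csSup ⟨0, zero_mem_rankedSet x k⟩ (by rw [← ranked]; linarith)
  choose t ht hlt using hex
  obtain ⟨s, -, hs⟩ := exists_sum_le h0 t ht n
  have h2 : ∑ k ∈ Finset.range n, (ranked x k - ε / (n + 1)) ≤ ∑ k ∈ Finset.range n, t k :=
    Finset.sum_le_sum fun k _ => (hlt k).le
  rw [Finset.sum_sub_distrib, Finset.sum_const, Finset.card_range, nsmul_eq_mul] at h2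
  have h3 : (n : ℝ) * (ε / (n + 1)) ≤ ε := by
    rw [← mul_div_assoc, div_le_iff₀ (by positivity)]
    nlinarith
  linarith [hA s]

/-- Ranking preserves sums. -/
theorem tsum_ranked (h0 : ∀ i, 0 ≤ x i) (h1 : ∀ i, x i ≤ 1) (hx : Summable x) :
    ∑' k, ranked x k = ∑' i, x i := by
  have hA : ∀ s : Finset ι, ∑ i ∈ s, x i ≤ ∑' i, x i := fun s =>
    hx.sum_le_tsum s fun i _ => h0 i
  have hs : Summable (ranked x) :=
    summable_of_sum_range_le (ranked_nonneg h1) (sum_ranked_le_of_sum_le h0 hA)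
  refine le_antisymm
    (Real.tsum_le_of_sum_range_le (ranked_nonneg h1) (sum_ranked_le_of_sum_le h0 hA)) ?_
  refine hx.tsum_le_of_sum_le fun s => ?_
  exact (sum_le_sum_ranked h1 _ s rfl).trans (hs.sum_le_tsum _ fun k _ => ranked_nonneg h1 k)

theorem tsum_ranked_pow (h0 : ∀ i, 0 ≤ x i) (h1 : ∀ s : Finset ι, ∑ i ∈ s, x i ≤ 1) {j : ℕ}
    (hj : j ≠ 0) : ∑' k, ranked x k ^ j = ∑' i, x i ^ j := by
  have h2 := le_one_of_sum_le h1
  have hle : ∀ i, x i ^ j ≤ x i := fun i => pow_le_of_le_one (h0 i) (h2 i) hj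
  rw [← tsum_ranked (x := fun i => x i ^ j) (fun i => pow_nonneg (h0 i) j)
    (fun i => pow_le_one₀ (h0 i) (h2 i))
    (Summable.of_nonneg_of_le (fun i => pow_nonneg (h0 i) j) hle (summable_of_sum_le h0 h1))]
  exact tsum_congr fun k => (ranked_pow h0 h2 hj k).symm

end RankedPow

/-! ### Power sums on the simplex -/

theorem rankedSimplex_mul_le (x : rankedSimplex) (i : ℕ) : ((i : ℝ) + 1) * x.1 i ≤ 1 := by
  have hanti : Antitone x.1 := antitone_nat_of_succ_le x.2.1
  have h1 : ∑ _k ∈ Finset.range (i + 1), x.1 i ≤ ∑ k ∈ Finset.range (i + 1), x.1 k :=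
    Finset.sum_le_sum fun k hk => hanti (by have := Finset.mem_range.1 hk; omega)
  have h2 := x.2.2.2.1.sum_le_tsum (Finset.range (i + 1)) fun k _ => x.2.2.1 k
  simp only [Finset.sum_const, Finset.card_range, nsmul_eq_mul] at h1
  push_cast at h1
  linarith [x.2.2.2.2]

theorem rankedSimplex_le (x : rankedSimplex) (i : ℕ) : x.1 i ≤ 1 / ((i : ℝ) + 1) := by
  rw [le_div_iff₀ (by positivity), mul_comm]
  exact rankedSimplex_mul_le x i

theorem rankedSimplex_le_one (x : rankedSimplex) (i : ℕ) : x.1 i ≤ 1 :=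
  (rankedSimplex_le x i).trans (div_le_one_of_le₀ (by linarith [(Nat.cast_nonneg i : (0:ℝ) ≤ i)])
    (by positivity))

theorem isClosed_rankedSimplex : IsClosed rankedSimplex := by
  have : rankedSimplex = {x : ℕ → ℝ | (∀ i, x (i + 1) ≤ x i) ∧ (∀ i, 0 ≤ x i) ∧
      ∀ n, ∑ i ∈ Finset.range n, x i ≤ 1} := by
    ext x
    constructor
    · rintro ⟨h1, h2, h3, h4⟩
      exact ⟨h1, h2, fun n => (h3.sum_le_tsum _ fun k _ => h2 k).trans h4⟩
    · rintro ⟨h1, h2, h3⟩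
      exact ⟨h1, h2, summable_of_sum_range_le h2 h3, Real.tsum_le_of_sum_range_le h2 h3⟩
  rw [this]
  simp only [Set.ofPred_and, Set.ofPred_forall]
  refine (isClosed_iInter fun i => isClosed_le ?_ ?_).inter
    ((isClosed_iInter fun i => isClosed_le ?_ ?_).inter (isClosed_iInter fun n =>
      isClosed_le ?_ ?_)) <;> fun_prop

instance compactSpace_rankedSimplex : CompactSpace rankedSimplex := by
  rw [← isCompact_iff_compactSpace]
  refine (isCompact_univ_pi fun _ : ℕ => isCompact_Icc (a := (0 : ℝ)) (b := 1)).of_isClosed_subset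
    isClosed_rankedSimplex fun x hx i _ => ⟨hx.2.1 i, rankedSimplex_le_one ⟨x, hx⟩ i⟩

/-- The sum of the `j`-th powers of the terms. -/
def powerSum (j : ℕ) (x : rankedSimplex) : ℝ := ∑' i, x.1 i ^ j

theorem summable_pow_of_two_le {j : ℕ} (hj : 2 ≤ j) (x : rankedSimplex) :
    Summable fun i => x.1 i ^ j :=
  Summable.of_nonneg_of_le (fun i => pow_nonneg (x.2.2.1 i) j)
    (fun i => pow_le_of_le_one (x.2.2.1 i) (rankedSimplex_le_one x i) (by omega)) x.2.2.2.1

theorem powerSum_nonneg (j : ℕ) (x : rankedSimplex) : 0 ≤ powerSum j x :=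
  tsum_nonneg fun i => pow_nonneg (x.2.2.1 i) j

theorem powerSum_le_one {j : ℕ} (hj : 2 ≤ j) (x : rankedSimplex) : powerSum j x ≤ 1 :=
  ((summable_pow_of_two_le hj x).tsum_le_tsum
    (fun i => pow_le_of_le_one (x.2.2.1 i) (rankedSimplex_le_one x i) (by omega))
    x.2.2.2.1).trans x.2.2.2.2

theorem continuous_powerSum {j : ℕ} (hj : 2 ≤ j) : Continuous (powerSum j) := by
  have hs : Summable fun i : ℕ => (1 / ((i : ℝ) + 1)) ^ 2 := by
    have := (summable_nat_add_iff 1).2 (Real.summable_one_div_nat_pow.2 (by norm_num : 1 < 2))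
    refine this.congr fun i => ?_
    push_cast
    rw [div_pow, one_pow]
  refine continuous_tsum
    (fun i => ((continuous_apply i).comp continuous_subtype_val).pow j) hs fun i x => ?_
  rw [Real.norm_eq_abs, abs_of_nonneg (pow_nonneg (x.2.2.1 i) j)]
  exact (pow_le_pow_of_le_one (x.2.2.1 i) (rankedSimplex_le_one x i) hj).trans
    (pow_le_pow_left₀ (x.2.2.1 i) (rankedSimplex_le x i) 2)

/-- If all power sums agree and the first `k` terms agree, then so do the next ones: the larger of
the two would dominate the power sums of high order. -/
theorem not_lt_of_powerSum_eq {x y : rankedSimplex} (h : ∀ j, 2 ≤ j → powerSum j x = powerSum j y)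
    (k : ℕ) (hk : ∀ i < k, x.1 i = y.1 i) : ¬ x.1 k < y.1 k := by
  intro hlt
  have hx0 := x.2.2.1 k
  have hy0 : 0 < y.1 k := hx0.trans_lt hlt
  have hanti : Antitone x.1 := antitone_nat_of_succ_le x.2.1
  -- comparing the tails from the index `k` on, whose largest terms differ
  have hle : ∀ j : ℕ, y.1 k ^ (j + 2) ≤ x.1 k ^ (j + 1) := by
    intro j
    have hsx := summable_pow_of_two_le (by omega : 2 ≤ j + 2) x
    have hsy := summable_pow_of_two_le (by omega : 2 ≤ j + 2) y
    have he := h (j + 2) (by omega)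
    rw [powerSum, powerSum, ← hsx.sum_add_tsum_nat_add k, ← hsy.sum_add_tsum_nat_add k,
      Finset.sum_congr rfl fun i hi => by rw [hk i (Finset.mem_range.1 hi)]] at he
    have he' := add_left_cancel he
    have h1 : y.1 k ^ (j + 2) ≤ ∑' i, y.1 (i + k) ^ (j + 2) := by
      have := ((summable_nat_add_iff k).2 hsy).le_tsum 0 fun i _ =>
        pow_nonneg (y.2.2.1 (i + k)) (j + 2)
      simpa using this
    have h2 : ∑' i, x.1 (i + k) ^ (j + 2) ≤ ∑' i, x.1 k ^ (j + 1) * x.1 (i + k) := by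
      refine ((summable_nat_add_iff k).2 hsx).tsum_le_tsum (fun i => ?_)
        (((summable_nat_add_iff k).2 x.2.2.2.1).mul_left _)
      rw [pow_succ]
      exact mul_le_mul_of_nonneg_right (pow_le_pow_left₀ (x.2.2.1 _) (hanti (by omega)) _)
        (x.2.2.1 _)
    have h3 : ∑' i, x.1 (i + k) ≤ 1 := by
      have := x.2.2.2.1.sum_add_tsum_nat_add k
      have h4 : 0 ≤ ∑ i ∈ Finset.range k, x.1 i := Finset.sum_nonneg fun i _ => x.2.2.1 i
      linarith [x.2.2.2.2]
    rw [tsum_mul_left] at h2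
    have h5 := mul_le_mul_of_nonneg_left h3 (pow_nonneg hx0 (j + 1))
    linarith
  have hr1 : x.1 k / y.1 k < 1 := (div_lt_one hy0).2 hlt
  have hlim : Tendsto (fun j : ℕ => (x.1 k / y.1 k) ^ (j + 1)) atTop (𝓝 0) :=
    (tendsto_pow_atTop_nhds_zero_of_lt_one (by positivity) hr1).comp (tendsto_add_atTop_nat 1)
  have := ge_of_tendsto' (b := y.1 k) hlim fun j => by
    rw [div_pow, le_div_iff₀ (by positivity), ← pow_succ']
    exact hle j
  linarith

theorem eq_of_powerSum_eq {x y : rankedSimplex} (h : ∀ j, 2 ≤ j → powerSum j x = powerSum j y) :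
    x = y := by
  refine Subtype.ext (funext fun k => ?_)
  induction k using Nat.strong_induction_on with
  | _ k ih =>
    refine le_antisymm (not_lt.1 ?_) (not_lt.1 ?_)
    · exact not_lt_of_powerSum_eq (fun j hj => (h j hj).symm) k fun i hi => (ih i hi).symm
    · exact not_lt_of_powerSum_eq h k ih

/-- Probability measures on the ranked simplex converge weakly as soon as the mixed moments of the
power sums of order at least two do: by the Stone-Weierstrass theorem, polynomials in these power
sums are dense in the continuous functions. -/
theorem tendsto_of_powerSum_moments {μs : ℕ → ProbabilityMeasure rankedSimplex}
    {μ : ProbabilityMeasure rankedSimplex}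
    (h : ∀ (r : ℕ) (J : Fin r → ℕ), (∀ i, 2 ≤ J i) →
      Tendsto (fun n => ∫ x, ∏ i, powerSum (J i) x ∂(μs n : Measure rankedSimplex)) atTop
        (𝓝 (∫ x, ∏ i, powerSum (J i) x ∂(μ : Measure rankedSimplex)))) :
    Tendsto μs atTop (𝓝 μ) := by
  rw [ProbabilityMeasure.tendsto_iff_forall_integral_tendsto]
  let P : {j : ℕ // 2 ≤ j} → C(rankedSimplex, ℝ) := fun j => ⟨powerSum j, continuous_powerSum j.2⟩
  let A : Subalgebra ℝ C(rankedSimplex, ℝ) := Algebra.adjoin ℝ (Set.range P)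
  have hsep : A.SeparatesPoints := by
    intro x y hxy
    by_contra hcon
    push Not at hcon
    refine hxy (eq_of_powerSum_eq fun j hj => ?_)
    exact hcon _ ⟨P ⟨j, hj⟩, Algebra.subset_adjoin ⟨_, rfl⟩, rfl⟩
  have hint : ∀ (ν : ProbabilityMeasure rankedSimplex) (g : C(rankedSimplex, ℝ)),
      Integrable g (ν : Measure rankedSimplex) := fun ν g =>
    (BoundedContinuousFunction.mkOfCompact g).integrable _
  have hA : ∀ g ∈ A, Tendsto (fun n => ∫ x, g x ∂(μs n : Measure rankedSimplex)) atTop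
      (𝓝 (∫ x, g x ∂(μ : Measure rankedSimplex))) := by
    intro g hg
    rw [← Subalgebra.mem_toSubmodule, Algebra.adjoin_eq_span] at hg
    induction hg using Submodule.span_induction with
    | mem g hg =>
      obtain ⟨l, hl, rfl⟩ := Submonoid.exists_list_of_mem_closure hg
      have hl' : ∀ i : Fin l.length, ∃ j : {j : ℕ // 2 ≤ j}, P j = l.get i := fun i =>
        hl _ (List.get_mem l i)
      choose J hJ using hl'
      have hprod : ∀ x, l.prod x = ∏ i, powerSum (J i) x := by
        intro x
        have : l.prod = ∏ i, P (J i) := by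
          simp only [hJ]
          rw [← List.prod_ofFn, List.ofFn_get]
        rw [this, ContinuousMap.coe_prod, Finset.prod_apply]
        rfl
      simp only [hprod]
      exact h _ (fun i => J i) fun i => (J i).2
    | zero => simp
    | add f g _ _ hf hg =>
      simp only [ContinuousMap.add_apply]
      simp_rw [integral_add (hint _ f) (hint _ g)]
      exact hf.add hg
    | smul c f _ hf =>
      simp only [ContinuousMap.smul_apply, integral_smul]
      exact hf.const_smul c
  intro f
  rw [Metric.tendsto_atTop]
  intro ε hε
  obtain ⟨⟨g, hgA⟩, hg⟩ := ContinuousMap.exists_mem_subalgebra_near_continuous_of_separatesPoints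
    A hsep f f.continuous (ε / 3) (by positivity)
  have hclose : ∀ ν : ProbabilityMeasure rankedSimplex,
      |∫ x, g x ∂(ν : Measure rankedSimplex) - ∫ x, f x ∂(ν : Measure rankedSimplex)| ≤ ε / 3 := by
    intro ν
    rw [← integral_sub (hint ν g) (f.integrable _), ← Real.norm_eq_abs]
    refine (norm_integral_le_of_norm_le_const (C := ε / 3)
      (Eventually.of_forall fun x => (hg x).le)).trans ?_
    simp
  obtain ⟨N, hN⟩ := Metric.tendsto_atTop.1 (hA g hgA) (ε / 3) (by positivity)
  refine ⟨N, fun n hn => ?_⟩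
  have h1 := hN n hn
  have h2 := abs_le.1 (hclose (μs n))
  have h3 := abs_le.1 (hclose μ)
  rw [Real.dist_eq, abs_lt] at h1 ⊢
  constructor <;> linarith [h1.1, h1.2, h2.1, h2.2, h3.1, h3.2]

/-! ### Moments of the Poisson–Dirichlet distribution -/

theorem beta_one_left {θ : ℝ} (hθ : 0 < θ) : beta 1 θ = 1 / θ := by
  have := (Real.Gamma_pos_of_pos hθ).ne'
  rw [beta, Real.Gamma_one, add_comm, Real.Gamma_add_one hθ.ne']
  field_simp

/-- The moments of `1 - B` for a `Beta(1, θ)` variable `B`. -/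
theorem integral_one_sub_pow_betaUnit {θ : ℝ} (hθ : 0 < θ) (b : ℕ) :
    ∫ u, (1 - (u : ℝ)) ^ b ∂betaUnit θ = θ / (b + θ) := by
  have hbθ : 0 < (b : ℝ) + θ := by positivity
  rw [integral_eq_lintegral_of_nonneg_ae (Eventually.of_forall fun u =>
    pow_nonneg (sub_nonneg.2 u.2.2) b) (by fun_prop)]
  have h1 : ∫⁻ u : unitInterval, ENNReal.ofReal ((1 - (u : ℝ)) ^ b) ∂betaUnit θ =
      ∫⁻ x in Set.Icc (0 : ℝ) 1, ENNReal.ofReal ((1 - x) ^ b) ∂betaMeasure 1 θ :=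
    lintegral_subtype_comap (μ := betaMeasure 1 θ) measurableSet_Icc
      fun x => ENNReal.ofReal ((1 - x) ^ b)
  have hm : Measurable (betaPDF 1 θ) := (measurable_betaPDFReal 1 θ).ennreal_ofReal
  have h2 : ∫⁻ x in Set.Icc (0 : ℝ) 1, ENNReal.ofReal ((1 - x) ^ b) ∂betaMeasure 1 θ =
      ∫⁻ x, ENNReal.ofReal (θ / (b + θ)) * betaPDF 1 (b + θ) x := by
    rw [betaMeasure, restrict_withDensity measurableSet_Icc,
      lintegral_withDensity_eq_lintegral_mul _ hm (by fun_prop),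
      ← lintegral_indicator measurableSet_Icc]
    refine lintegral_congr fun x => ?_
    by_cases hx : 0 < x ∧ x < 1
    · have hx1 : 0 < 1 - x := by linarith [hx.2]
      rw [Set.indicator_of_mem (Set.mem_Icc.2 ⟨hx.1.le, hx.2.le⟩), Pi.mul_apply,
        betaPDF_of_pos_lt_one hx.1 hx.2, betaPDF_of_pos_lt_one hx.1 hx.2, beta_one_left hθ,
        beta_one_left hbθ, add_sub_assoc, Real.rpow_add hx1, Real.rpow_natCast, sub_self,
        Real.rpow_zero]
      generalize 1 - x = y at *
      rw [← ENNReal.ofReal_mul (by positivity), ← ENNReal.ofReal_mul (by positivity)]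
      congr 1
      field_simp
    · have h0 : betaPDF 1 (b + θ) x = 0 := by rw [betaPDF_eq, if_neg hx, ENNReal.ofReal_zero]
      have h0' : betaPDF 1 θ x = 0 := by rw [betaPDF_eq, if_neg hx, ENNReal.ofReal_zero]
      rw [h0, mul_zero, Set.indicator_apply_eq_zero]
      intro _
      rw [Pi.mul_apply, h0', zero_mul]
  rw [h1, h2, lintegral_const_mul _
    (show Measurable (betaPDF 1 (b + θ)) from (measurable_betaPDFReal 1 _).ennreal_ofReal),
    lintegral_betaPDF_eq_one one_pos hbθ, mul_one, ENNReal.toReal_ofReal (by positivity)]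

/-- The mixed moments of `B` and `1 - B` for a `Beta(1, θ)` variable `B`. -/
def betaMoment (θ : ℝ) (a b : ℕ) : ℝ := ∫ u, (u : ℝ) ^ a * (1 - (u : ℝ)) ^ b ∂betaUnit θ

theorem betaMoment_zero {θ : ℝ} (hθ : 0 < θ) (b : ℕ) : betaMoment θ 0 b = θ / (b + θ) := by
  simpa [betaMoment] using integral_one_sub_pow_betaUnit hθ b

theorem integrable_unitInterval {μ : Measure unitInterval} [IsFiniteMeasure μ]
    {f : unitInterval → ℝ} (hf : Continuous f) : Integrable f μ :=
  (BoundedContinuousFunction.mkOfCompact ⟨f, hf⟩).integrable μ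

theorem betaMoment_succ {θ : ℝ} (hθ : 0 < θ) (a b : ℕ) :
    betaMoment θ (a + 1) b = betaMoment θ a b - betaMoment θ a (b + 1) := by
  have := isProbabilityMeasure_betaUnit hθ
  unfold betaMoment
  rw [← integral_sub (integrable_unitInterval (by fun_prop))
    (integrable_unitInterval (by fun_prop))]
  refine integral_congr_ae (Eventually.of_forall fun u => ?_)
  simp only
  ring

/-! ### Breaking off the first stick -/

/-- Prepending a term to a sequence. -/
def consSeq {X : Type*} (x : X) (b : ℕ → X) : ℕ → X
  | 0 => x
  | k + 1 => b k

theorem measurable_consSeq {X : Type*} [MeasurableSpace X] :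
    Measurable fun p : X × (ℕ → X) => consSeq p.1 p.2 := by
  refine measurable_pi_lambda _ fun k => ?_
  cases k with
  | zero => exact measurable_fst
  | succ k => exact (measurable_pi_apply k).comp measurable_snd

/-- Prepending an independent term to an i.i.d. sequence gives an i.i.d. sequence. -/
theorem map_consSeq_prod {X : Type*} [MeasurableSpace X] (ν : Measure X) [IsProbabilityMeasure ν] :
    (ν.prod (Measure.infinitePi fun _ : ℕ => ν)).map (fun p => consSeq p.1 p.2) =
      Measure.infinitePi fun _ : ℕ => ν := by
  classical
  refine Measure.eq_infinitePi _ fun s t ht => ?_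
  obtain ⟨N, hN⟩ := s.exists_nat_subset_range
  set t' : ℕ → Set X := fun i => if i ∈ s then t i else Set.univ with ht'
  have hmt' : ∀ i, MeasurableSet (t' i) := fun i => by
    rw [ht']
    dsimp only
    split_ifs
    exacts [ht i, MeasurableSet.univ]
  have hpi : Set.pi (s : Set ℕ) t = Set.pi (Finset.range (N + 1) : Set ℕ) t' := by
    ext x
    simp only [Set.mem_pi, Finset.mem_coe, ht']
    constructor
    · intro h i _
      split_ifs with hi
      exacts [h i hi, Set.mem_univ _]
    · intro h i hi
      have := h i (Finset.range_subset_range.2 (Nat.le_succ N) (hN hi))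
      rwa [if_pos hi] at this
  have hprod : ∏ i ∈ s, ν (t i) = ∏ i ∈ Finset.range (N + 1), ν (t' i) := by
    refine Finset.prod_subset_one_on_sdiff (hN.trans (Finset.range_subset_range.2 (Nat.le_succ N)))
      (fun i hi => ?_) fun i hi => ?_
    · rw [ht']
      dsimp only
      rw [if_neg (Finset.mem_sdiff.1 hi).2, measure_univ]
    · rw [ht']
      dsimp only
      rw [if_pos hi]
  have hpre : (fun p : X × (ℕ → X) => consSeq p.1 p.2) ⁻¹' Set.pi (Finset.range (N + 1) : Set ℕ) t' =
      t' 0 ×ˢ Set.pi (Finset.range N : Set ℕ) fun i => t' (i + 1) := by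
    ext ⟨x, b⟩
    simp only [Set.mem_preimage, Set.mem_pi, Finset.mem_coe, Finset.mem_range, Set.mem_prod]
    constructor
    · exact fun h => ⟨h 0 (by omega), fun i hi => h (i + 1) (by omega)⟩
    · rintro ⟨h0, h⟩ i hi
      cases i with
      | zero => exact h0
      | succ i => exact h i (by omega)
  rw [hpi, Measure.map_apply measurable_consSeq
    (MeasurableSet.pi (Finset.countable_toSet _) fun i _ => hmt' i), hpre, Measure.prod_prod,
    Measure.infinitePi_pi _ fun i _ => hmt' (i + 1), hprod, Finset.prod_range_succ', mul_comm]

theorem stick_consSeq_zero (u : unitInterval) (b : ℕ → unitInterval) :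
    stick (consSeq u b) 0 = u := by simp [stick, consSeq]

theorem stick_consSeq_succ (u : unitInterval) (b : ℕ → unitInterval) (k : ℕ) :
    stick (consSeq u b) (k + 1) = (1 - u) * stick b k := by
  simp only [stick, Finset.prod_range_succ', consSeq]
  ring

theorem powerSum_rankedStick {j : ℕ} (hj : j ≠ 0) (b : ℕ → unitInterval) :
    powerSum j (rankedStick b) = ∑' k, stick b k ^ j :=
  tsum_ranked_pow (stick_nonneg b) (sum_stick_le b) hj

theorem powerSum_rankedStick_consSeq {j : ℕ} (hj : j ≠ 0) (u : unitInterval)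
    (b : ℕ → unitInterval) : powerSum j (rankedStick (consSeq u b)) =
      (u : ℝ) ^ j + (1 - u) ^ j * powerSum j (rankedStick b) := by
  have hs : Summable fun k => stick (consSeq u b) k ^ j := by
    have h1 := le_one_of_sum_le (sum_stick_le (consSeq u b))
    exact Summable.of_nonneg_of_le (fun k => pow_nonneg (stick_nonneg _ k) j)
      (fun k => pow_le_of_le_one (stick_nonneg _ k) (h1 k) hj)
      (summable_of_sum_le (stick_nonneg _) (sum_stick_le _))
  rw [powerSum_rankedStick hj, powerSum_rankedStick hj, hs.tsum_eq_zero_add, stick_consSeq_zero,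
    ← tsum_mul_left]
  simp only [stick_consSeq_succ, mul_pow]

variable {ι : Type*} [DecidableEq ι]

/-- The mixed moments of the power sums under the Poisson-Dirichlet distribution satisfy the
recursion obtained by breaking off the first stick. -/
theorem poissonDirichlet_moment_recursion {θ : ℝ} (hθ : 0 < θ) {J : ι → ℕ} (hJ : ∀ i, 2 ≤ J i)
    (s : Finset ι) :
    ∫ x, ∏ i ∈ s, powerSum (J i) x ∂(poissonDirichlet θ hθ : Measure rankedSimplex) =
      ∑ t ∈ s.powerset, betaMoment θ (∑ i ∈ t, J i) (∑ i ∈ s \ t, J i) *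
        ∫ x, ∏ i ∈ s \ t, powerSum (J i) x ∂(poissonDirichlet θ hθ : Measure rankedSimplex) := by
  have := isProbabilityMeasure_betaUnit hθ
  set P := Measure.infinitePi fun _ : ℕ => betaUnit θ with hP
  have hcont : ∀ s : Finset ι, Continuous fun x => ∏ i ∈ s, powerSum (J i) x := fun s =>
    continuous_finsetProd _ fun i _ => continuous_powerSum (hJ i)
  have hPD : ∀ s : Finset ι,
      ∫ x, ∏ i ∈ s, powerSum (J i) x ∂(poissonDirichlet θ hθ : Measure rankedSimplex) =
      ∫ b, ∏ i ∈ s, powerSum (J i) (rankedStick b) ∂P := fun s =>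
    integral_map measurable_rankedStick.aemeasurable (hcont s).measurable.aestronglyMeasurable
  have hint : ∀ s : Finset ι, Integrable (fun b => ∏ i ∈ s, powerSum (J i) (rankedStick b)) P := by
    intro s
    refine Integrable.of_bound ((hcont s).measurable.comp measurable_rankedStick).aestronglyMeasurable
      1 (Eventually.of_forall fun b => ?_)
    rw [Real.norm_eq_abs, abs_of_nonneg (Finset.prod_nonneg fun i _ => powerSum_nonneg _ _)]
    exact Finset.prod_le_one (fun i _ => powerSum_nonneg _ _) fun i _ => powerSum_le_one (hJ i) _
  simp only [hPD]
  conv_lhs => rw [hP, ← map_consSeq_prod (betaUnit θ)]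
  rw [integral_map (f := fun b => ∏ i ∈ s, powerSum (J i) (rankedStick b))
    measurable_consSeq.aemeasurable
    ((hcont s).measurable.comp measurable_rankedStick).aestronglyMeasurable]
  have hexp : ∀ p : unitInterval × (ℕ → unitInterval),
      ∏ i ∈ s, powerSum (J i) (rankedStick (consSeq p.1 p.2)) =
      ∑ t ∈ s.powerset, ((p.1 : ℝ) ^ (∑ i ∈ t, J i) * (1 - (p.1 : ℝ)) ^ (∑ i ∈ s \ t, J i)) *
        ∏ i ∈ s \ t, powerSum (J i) (rankedStick p.2) := by
    intro p
    have h2 : ∀ i, J i ≠ 0 := fun i => by have := hJ i; omega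
    simp only [powerSum_rankedStick_consSeq (h2 _)]
    rw [Finset.prod_add]
    refine Finset.sum_congr rfl fun t _ => ?_
    rw [Finset.prod_mul_distrib, Finset.prod_pow_eq_pow_sum, Finset.prod_pow_eq_pow_sum, mul_assoc]
  simp only [hexp]
  rw [integral_finsetSum]
  · refine Finset.sum_congr rfl fun t _ => ?_
    exact integral_prod_mul (fun u : unitInterval =>
      (u : ℝ) ^ (∑ i ∈ t, J i) * (1 - (u : ℝ)) ^ (∑ i ∈ s \ t, J i))
      (fun b => ∏ i ∈ s \ t, powerSum (J i) (rankedStick b))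
  · intro t _
    exact (integrable_unitInterval (f := fun u : unitInterval =>
      (u : ℝ) ^ (∑ i ∈ t, J i) * (1 - (u : ℝ)) ^ (∑ i ∈ s \ t, J i)) (by fun_prop)).mul_prod
      (hint (s \ t))

/-! ### Mixed moments of the component sizes -/

section Components

variable {n : ℕ} (f : Fin n → Fin n)

theorem reachable_iff_conn (u v : Fin n) :
    (mapDigraph f).toSimpleGraphInclusive.Reachable u v ↔ Conn f u v := by
  constructor
  · rintro ⟨p⟩
    induction p with
    | nil => exact Conn.refl f _
    | cons h _ ih =>
      refine Conn.trans ?_ ih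
      rcases h.2 with h | h
      · rw [← show f _ = _ from h]
        exact Conn.apply f _
      · rw [← show f _ = _ from h]
        exact (Conn.apply f _).symm
  · have hstep : ∀ u, (mapDigraph f).toSimpleGraphInclusive.Reachable u (f u) := by
      intro u
      rcases eq_or_ne u (f u) with h | h
      · rw [← h]
      · exact SimpleGraph.Adj.reachable ⟨h, Or.inl rfl⟩
    have hit : ∀ (i : ℕ) u, (mapDigraph f).toSimpleGraphInclusive.Reachable u (f^[i] u) := by
      intro i
      induction i with
      | zero => exact fun u => SimpleGraph.Reachable.refl u
      | succ i ih => exact fun u => (hstep u).trans (ih (f u))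
    rintro ⟨i, j, h⟩
    have := hit i u
    rw [h] at this
    exact this.trans (hit j v).symm

theorem size_mk (v : Fin n) :
    Component.size ((mapDigraph f).toSimpleGraphInclusive.connectedComponentMk v : Component f) =
      blockSize f v := by
  classical
  have : (((mapDigraph f).toSimpleGraphInclusive.connectedComponentMk v : Component f)).supp =
      ((Finset.univ.filter fun w => Conn f v w : Finset (Fin n)) : Set (Fin n)) := by
    ext w
    rw [SimpleGraph.ConnectedComponent.mem_supp_iff, SimpleGraph.ConnectedComponent.eq,
      reachable_iff_conn, Finset.coe_filter]
    exact ⟨fun h => ⟨Finset.mem_univ _, h.symm⟩, fun h => h.2.symm⟩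
  rw [Component.size, this, Set.ncard_coe_finset, Finset.card_filter]
  exact Finset.sum_congr rfl fun w _ => if_congr Iff.rfl rfl rfl

theorem sum_size_pow {j : ℕ} (hj : j ≠ 0) [Fintype (Component f)] :
    ∑ c : Component f, c.size ^ j = sizePowerSum f j := by
  classical
  let g : Fin n → Component f :=
    fun v => (mapDigraph f).toSimpleGraphInclusive.connectedComponentMk v
  unfold sizePowerSum
  rw [← Finset.sum_fiberwise Finset.univ g]
  refine Finset.sum_congr rfl fun c _ => ?_
  rw [Finset.sum_congr rfl (g := fun _ => c.size ^ (j - 1)) fun v hv => by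
    rw [← size_mk, show (mapDigraph f).toSimpleGraphInclusive.connectedComponentMk v = c from
      (Finset.mem_filter.1 hv).2]]
  rw [Finset.sum_const, smul_eq_mul]
  have : (Finset.univ.filter fun v => g v = c).card = c.size := by
    rw [Component.size, ← Set.ncard_coe_finset]
    congr 1
    ext v
    simp [g, SimpleGraph.ConnectedComponent.mem_supp_iff]
  rw [this, mul_pow_sub_one hj]

/-- For `n = 0` both sides vanish, as there are no components and the division is by zero. -/
theorem powerSum_componentOrderStatistics {j : ℕ} (hj : j ≠ 0) :
    powerSum j (componentOrderStatistics f) = (sizePowerSum f j : ℝ) / (n : ℝ) ^ j := by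
  have : Fintype (Component f) := Fintype.ofFinite _
  rw [powerSum, componentOrderStatistics, tsum_ranked_pow (fun c => by positivity) (fun s => by
    rw [← Finset.sum_div, ← Nat.cast_sum]
    exact div_le_one_of_le₀ (by exact_mod_cast Component.sum_size_le s) (Nat.cast_nonneg n)) hj,
    tsum_fintype, ← sum_size_pow f hj]
  push_cast
  rw [Finset.sum_div]
  exact Finset.sum_congr rfl fun c _ => div_pow _ _ _

end Components

section Moments

variable {ι : Type*}

/-- The mixed moments of the power sums of the normalized component sizes. For `n = 0` the quotient
is `0 / 0 = 0`, unless `s` is empty. -/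
def componentMoment (m : ℕ) (J : ι → ℕ) (s : Finset ι) (n : ℕ) : ℝ :=
  (momentSum m (Fin n) J s : ℝ) / (((n * m).descFactorial n : ℕ) * (n : ℝ) ^ ∑ i ∈ s, J i)

theorem integral_powerSum_componentLaw {m : ℕ} (hm : 0 < m) {J : ι → ℕ} (hJ : ∀ i, 2 ≤ J i)
    (s : Finset ι) (n : ℕ) :
    ∫ x, ∏ i ∈ s, powerSum (J i) x ∂(componentLaw m n hm : Measure rankedSimplex) =
      componentMoment m J s n := by
  have h2 : ∀ i, J i ≠ 0 := fun i => by have := hJ i; omega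
  rw [integral_componentLaw hm _ (continuous_finsetProd _ fun i _ => continuous_powerSum (hJ i)),
    componentMoment, mul_comm (((n * m).descFactorial n : ℕ) : ℝ), ← div_div, momentSum]
  congr 1
  push_cast
  rw [Finset.sum_div]
  refine Finset.sum_congr rfl fun f _ => ?_
  rw [mul_div_assoc]
  congr 1
  simp only [powerSum_componentOrderStatistics _ (h2 _)]
  rw [Finset.prod_div_distrib, Finset.prod_pow_eq_pow_sum]

theorem abs_componentMoment_le {m : ℕ} (hm : 0 < m) {J : ι → ℕ} (hJ : ∀ i, 2 ≤ J i)
    (s : Finset ι) (n : ℕ) : |componentMoment m J s n| ≤ 1 := by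
  rw [← integral_powerSum_componentLaw hm hJ, ← Real.norm_eq_abs]
  refine (norm_integral_le_of_norm_le_const (C := 1) (Eventually.of_forall fun x => ?_)).trans
    (by simp)
  rw [Real.norm_eq_abs, abs_of_nonneg (Finset.prod_nonneg fun i _ => powerSum_nonneg _ _)]
  exact Finset.prod_le_one (fun i _ => powerSum_nonneg _ _) fun i _ => powerSum_le_one (hJ i) _

/-- The total weight of the mappings of `n` points divided by `n!`, namely `(m * n).choose n`, times
the geometric factor `chooseRate m ^ n`. -/
def totalCoeff (m n : ℕ) : ℝ := ((m * n).choose n : ℕ) * chooseRate m ^ n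

/-- The total weight of the connected mappings of `n` points with a marked point divided by `n!`,
times the geometric factor `chooseRate m ^ n`. -/
def connCoeff (m n : ℕ) : ℝ :=
  n * connWeight m (Fin n) / n.factorial * chooseRate m ^ n

theorem totalCoeff_pos {m : ℕ} (hm : 2 ≤ m) (n : ℕ) : 0 < totalCoeff m n := by
  have h1 := chooseRate_pos hm
  have h2 : 0 < (m * n).choose n := Nat.choose_pos (Nat.le_mul_of_pos_left n (by omega))
  unfold totalCoeff
  positivity

theorem connCoeff_nonneg {m : ℕ} (hm : 2 ≤ m) (n : ℕ) : 0 ≤ connCoeff m n := by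
  have h1 := chooseRate_pos hm
  unfold connCoeff
  positivity

/-- The identity also holds for `n = 0`, where the power sums and `0 ^ ∑ i ∈ s, J i` both vanish
unless `s` is empty. -/
theorem momentSum_eq {m : ℕ} (hm : 2 ≤ m) (J : ι → ℕ) (s : Finset ι)
    (n : ℕ) : (momentSum m (Fin n) J s : ℝ) / n.factorial * chooseRate m ^ n =
      totalCoeff m n * ((n : ℝ) ^ (∑ i ∈ s, J i) * componentMoment m J s n) := by
  have hd : (((n * m).descFactorial n : ℕ) : ℝ) = n.factorial * ((m * n).choose n : ℕ) := by
    rw [Nat.descFactorial_eq_factorial_mul_choose, mul_comm n m]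
    push_cast
    rfl
  have h2 : ((m * n).choose n : ℝ) ≠ 0 := by
    have := Nat.choose_pos (Nat.le_mul_of_pos_left n (by omega : 0 < m))
    positivity
  have h3 : (n.factorial : ℝ) ≠ 0 := by positivity
  have key : (n : ℝ) ^ (∑ i ∈ s, J i) * componentMoment m J s n =
      (momentSum m (Fin n) J s : ℝ) / (((n * m).descFactorial n : ℕ)) := by
    rw [componentMoment]
    rcases eq_or_ne n 0 with rfl | hn
    · rcases s.eq_empty_or_nonempty with rfl | ⟨i, hi⟩
      · simp
      · have h0 : momentSum m (Fin 0) J s = 0 := by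
          refine Finset.sum_eq_zero fun f _ => ?_
          rw [Finset.prod_eq_zero hi (by simp [sizePowerSum]), mul_zero]
        simp [h0]
    · have : (n : ℝ) ^ (∑ i ∈ s, J i) ≠ 0 := pow_ne_zero _ (by exact_mod_cast hn)
      rw [hd]
      field_simp
  rw [key, hd, totalCoeff]
  field_simp

theorem componentMoment_empty {m : ℕ} (hm : 0 < m) (J : ι → ℕ) (n : ℕ) :
    componentMoment m J ∅ n = 1 := by
  have h0 : ((n * m).descFactorial n : ℝ) ≠ 0 := by
    have : n ≤ n * m := Nat.le_mul_of_pos_right n hm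
    rw [Nat.cast_ne_zero, ne_eq, Nat.descFactorial_eq_zero_iff_lt]
    omega
  simp only [componentMoment, momentSum, Finset.prod_empty, mul_one, sum_weight hm,
    Finset.sum_empty, pow_zero, div_self h0]

variable [DecidableEq ι]

/-- The first-component decomposition `card_mul_momentSum`, in normalized form. -/
theorem totalCoeff_mul_componentMoment {m : ℕ} (hm : 2 ≤ m) {J : ι → ℕ} (hJ : ∀ i, 2 ≤ J i)
    (s : Finset ι) (n : ℕ) :
    n * (totalCoeff m n * ((n : ℝ) ^ (∑ i ∈ s, J i) * componentMoment m J s n)) =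
      ∑ p ∈ antidiagonal n, connCoeff m p.1 * ∑ t ∈ s.powerset, (p.1 : ℝ) ^ (∑ i ∈ t, J i) *
        (totalCoeff m p.2 * ((p.2 : ℝ) ^ (∑ i ∈ s \ t, J i) * componentMoment m J (s \ t) p.2)) := by
  have h2 : ∀ i, J i ≠ 0 := fun i => by have := hJ i; omega
  have h := card_mul_momentSum (V := Fin n) m h2 s
  rw [Fintype.card_fin] at h
  have h' : (n : ℝ) * momentSum m (Fin n) J s = ∑ k ∈ Finset.range (n + 1),
      (n.choose k : ℝ) * (k * (connWeight m (Fin k) * ∑ t ∈ s.powerset,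
        (k : ℝ) ^ (∑ i ∈ t, J i) * momentSum m (Fin (n - k)) J (s \ t))) := by exact_mod_cast h
  simp only [← momentSum_eq hm J]
  rw [Finset.Nat.sum_antidiagonal_eq_sum_range_succ_mk]
  rw [show (n : ℝ) * ((momentSum m (Fin n) J s : ℝ) / n.factorial * chooseRate m ^ n) =
    n * momentSum m (Fin n) J s / n.factorial * chooseRate m ^ n by ring, h', Finset.sum_div,
    Finset.sum_mul]
  refine Finset.sum_congr rfl fun k hk => ?_
  have hkn : k ≤ n := Nat.lt_succ_iff.1 (Finset.mem_range.1 hk)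
  have hpow : chooseRate m ^ n = chooseRate m ^ k * chooseRate m ^ (n - k) := by
    rw [← pow_add, Nat.add_sub_cancel' hkn]
  have hsum : ∑ t ∈ s.powerset, (k : ℝ) ^ (∑ i ∈ t, J i) *
      ((momentSum m (Fin (n - k)) J (s \ t) : ℝ) / (n - k).factorial * chooseRate m ^ (n - k)) =
      (∑ t ∈ s.powerset, (k : ℝ) ^ (∑ i ∈ t, J i) * momentSum m (Fin (n - k)) J (s \ t)) /
        (n - k).factorial * chooseRate m ^ (n - k) := by
    rw [Finset.sum_div, Finset.sum_mul]
    exact Finset.sum_congr rfl fun t _ => by ring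
  rw [hsum, Nat.cast_choose ℝ hkn, hpow, connCoeff]
  field_simp

theorem conv_connCoeff_totalCoeff {m : ℕ} (hm : 2 ≤ m) (n : ℕ) :
    conv (connCoeff m) (totalCoeff m) n = n * totalCoeff m n := by
  have h := totalCoeff_mul_componentMoment hm (J := fun _ : ℕ => 2) (fun _ => le_rfl) ∅ n
  simpa [componentMoment_empty (by omega : 0 < m), conv] using h.symm

/-- The joint distribution of the size of the component of a uniformly chosen vertex and of the
number of remaining vertices. -/
def componentWeight (m n : ℕ) (p : ℕ × ℕ) : ℝ :=
  connCoeff m p.1 * totalCoeff m p.2 / (n * totalCoeff m n)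

theorem componentMoment_recursion {m : ℕ} (hm : 2 ≤ m) {J : ι → ℕ} (hJ : ∀ i, 2 ≤ J i)
    (s : Finset ι) {n : ℕ} (hn : 1 ≤ n) :
    componentMoment m J s n = ∑ p ∈ antidiagonal n, componentWeight m n p * ∑ t ∈ s.powerset,
      ((p.1 : ℝ) / n) ^ (∑ i ∈ t, J i) * ((p.2 : ℝ) / n) ^ (∑ i ∈ s \ t, J i) *
        componentMoment m J (s \ t) p.2 := by
  have h := totalCoeff_mul_componentMoment hm hJ s n
  have h1 := totalCoeff_pos hm n
  have hn0 : (n : ℝ) ≠ 0 := by positivity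
  have hne : (n : ℝ) * (totalCoeff m n * (n : ℝ) ^ (∑ i ∈ s, J i)) ≠ 0 := by positivity
  apply mul_left_cancel₀ hne
  rw [show (n : ℝ) * (totalCoeff m n * (n : ℝ) ^ (∑ i ∈ s, J i)) * componentMoment m J s n =
    n * (totalCoeff m n * ((n : ℝ) ^ (∑ i ∈ s, J i) * componentMoment m J s n)) by ring, h,
    Finset.mul_sum]
  refine Finset.sum_congr rfl fun p _ => ?_
  simp only [Finset.mul_sum]
  refine Finset.sum_congr rfl fun t ht => ?_
  rw [← Finset.sum_sdiff (Finset.mem_powerset.1 ht), pow_add, componentWeight, div_pow, div_pow]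
  field_simp

theorem tendsto_componentWeight_moment {m : ℕ} (hm : 2 ≤ m) (b : ℕ) :
    Tendsto (fun n : ℕ => ∑ p ∈ antidiagonal n, componentWeight m n p * ((p.2 : ℝ) / n) ^ b) atTop
      (𝓝 (betaMoment (1 / 2) 0 b)) := by
  obtain ⟨C, hC, hlim⟩ := tendsto_choose_div_multichoose_half hm
  have h := tendsto_renewal_moment hC (connCoeff_nonneg hm) (totalCoeff_pos hm) hlim
    (conv_connCoeff_totalCoeff hm) b
  have hv : betaMoment (1 / 2) 0 b = 1 / (2 * b + 1) := by
    rw [betaMoment_zero (by norm_num)]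
    field_simp
  rw [hv]
  refine h.congr' ?_
  filter_upwards [eventually_ge_atTop 1] with n hn
  have h1 := totalCoeff_pos hm n
  have hn0 : (n : ℝ) ≠ 0 := by positivity
  rw [conv, Finset.sum_div]
  refine Finset.sum_congr rfl fun p _ => ?_
  rw [componentWeight, div_pow, pow_succ]
  field_simp

end Moments

end AntiPref

end

theorem theorem7 (m : ℕ) (hm : 2 ≤ m) :
    Tendsto (fun n : ℕ => AntiPref.componentLaw m n (by omega)) atTop
      (𝓝 (AntiPref.poissonDirichlet (1 / 2) (by norm_num))) := by
  refine AntiPref.tendsto_of_powerSum_moments fun r J hJ => ?_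
  have hJ0 : ∀ i, J i ≠ 0 := fun i => by have := hJ i; omega
  have hm0 : 0 < m := by omega
  simp only [AntiPref.integral_powerSum_componentLaw hm0 hJ]
  refine AntiPref.tendsto_of_block_recursion (q := AntiPref.componentWeight m)
    (M := AntiPref.betaMoment (1 / 2))
    (Φ := AntiPref.componentMoment m J)
    (Ψ := fun s => ∫ x, ∏ i ∈ s, AntiPref.powerSum (J i) x
      ∂(AntiPref.poissonDirichlet (1 / 2) (by norm_num) : Measure AntiPref.rankedSimplex))
    (fun n p => div_nonneg (mul_nonneg (AntiPref.connCoeff_nonneg hm _)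
      (AntiPref.totalCoeff_pos hm _).le) (mul_nonneg n.cast_nonneg
      (AntiPref.totalCoeff_pos hm _).le))
    (AntiPref.betaMoment_succ (by norm_num)) (fun b hb => ?_)
    (AntiPref.tendsto_componentWeight_moment hm) hJ0 (AntiPref.abs_componentMoment_le hm0 hJ)
    (AntiPref.componentMoment_empty hm0 J) (by simp)
    (fun s n hn => AntiPref.componentMoment_recursion hm hJ s hn)
    (AntiPref.poissonDirichlet_moment_recursion (by norm_num) hJ) Finset.univ
  have : (0 : ℝ) < b := by exact_mod_cast Nat.pos_of_ne_zero hb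
  rw [AntiPref.betaMoment_zero (by norm_num), div_lt_one (by positivity)]
  linarith
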